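/- Let $n\ge 2$, let $H^n$ be the $n$-dimensional hyperbolic space (of constant curvature $-1$) with geodesic distance $d$ and $n$-dimensional Riemannian volume $V$, and for $z\in H^n$, $r>0$ let $B(z,r)=\{x\in H^n: d(x,z)\le r\}$. Fix $z_0\in H^n$. If $D>0$ and $X\subset H^n$ is (Lebesgue) measurable and bounded with $\operatorname{diam} X=\sup_{x,y\in X}d(x,y)\le D$, then $$V(X)\le V\bigl(B(z_0,D/2)\bigr).$$ Moreover, equality holds if and only if the closure $\overline X$ of $X$ is a ball of radius $D/2$ (that is, $\overline X=B(z,D/2)$ for some $z\in H^n$) and $V(\overline X\setminus X)=0$; in particular, for closed $X$ equality holds if and only if $X$ is a ball of radius $D/2$. -/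

import Mathlib

open MeasureTheory

/-- The Lorentzian symmetric bilinear form `𝓑(x₀ + t e, y₀ + s e) = t s - ⟨x₀, y₀⟩` on
`ℝⁿ⁺¹ = ℝⁿ × ℝ e`. -/
noncomputable def lorentz {n : ℕ} (p q : EuclideanSpace ℝ (Fin n) × ℝ) : ℝ :=
  p.2 * q.2 - inner ℝ p.1 q.1

/-- Hyperbolic `n`-space, as the upper sheet `t ≥ 1`, `t² - ⟨x, x⟩ = 1` of the hyperboloid
in `ℝⁿ × ℝ`. -/
def HyperbolicSpace (n : ℕ) : Type :=
  {p : EuclideanSpace ℝ (Fin n) × ℝ // 1 ≤ p.2 ∧ lorentz p p = 1}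

namespace HyperbolicSpace

variable {n : ℕ}

theorem lorentz_comm (p q : EuclideanSpace ℝ (Fin n) × ℝ) : lorentz p q = lorentz q p := by
  simp only [lorentz, real_inner_comm]; ring

theorem lorentz_add_smul (u w x : EuclideanSpace ℝ (Fin n) × ℝ) (s : ℝ) :
    lorentz (u + s • w) x = lorentz u x + s * lorentz w x := by
  simp [lorentz, inner_add_left, inner_smul_left]; ring

theorem time_sq (p : HyperbolicSpace n) : p.1.2 ^ 2 = 1 + ‖p.1.1‖ ^ 2 := by
  have h := p.2.2
  simp only [lorentz, real_inner_self_eq_norm_sq] at h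
  linarith

/-- On a tangent space of the hyperboloid the form is negative semidefinite (quantitatively). -/
theorem tangent_bound (p : HyperbolicSpace n) (u : EuclideanSpace ℝ (Fin n) × ℝ)
    (hu : lorentz u p.1 = 0) : p.1.2 ^ 2 * u.2 ^ 2 ≤ ‖u.1‖ ^ 2 * (p.1.2 ^ 2 - 1) := by
  have h1 : u.2 * p.1.2 = inner ℝ u.1 p.1.1 := by
    simp only [lorentz] at hu; linarith
  have h2 := abs_real_inner_le_norm u.1 p.1.1
  have h3 : (inner ℝ u.1 p.1.1) ^ 2 ≤ (‖u.1‖ * ‖p.1.1‖) ^ 2 := by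
    rw [← sq_abs]; gcongr
  have h4 := time_sq p
  calc p.1.2 ^ 2 * u.2 ^ 2 = (inner ℝ u.1 p.1.1) ^ 2 := by rw [← h1]; ring
    _ ≤ (‖u.1‖ * ‖p.1.1‖) ^ 2 := h3
    _ = _ := by rw [h4]; ring

theorem tangent_nonpos (p : HyperbolicSpace n) (u : EuclideanSpace ℝ (Fin n) × ℝ)
    (hu : lorentz u p.1 = 0) : lorentz u u ≤ 0 := by
  have h1 := tangent_bound p u hu
  have h2 := p.2.1
  simp only [lorentz, real_inner_self_eq_norm_sq]
  have h3 : 0 < p.1.2 ^ 2 := by positivity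
  by_contra! h
  nlinarith [sq_nonneg ‖u.1‖]

theorem tangent_cauchy_schwarz (p : HyperbolicSpace n) (u w : EuclideanSpace ℝ (Fin n) × ℝ)
    (hu : lorentz u p.1 = 0) (hw : lorentz w p.1 = 0) :
    lorentz u w ^ 2 ≤ lorentz u u * lorentz w w := by
  have key : ∀ s : ℝ, 0 ≤ (-lorentz w w) * (s * s) + (-2 * lorentz u w) * s
      + (-lorentz u u) := by
    intro s
    have h := tangent_nonpos p (u + s • w) (by rw [lorentz_add_smul, hu, hw]; ring)
    rw [lorentz_add_smul, lorentz_comm u, lorentz_comm w, lorentz_add_smul,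
      lorentz_add_smul, lorentz_comm w u] at h
    linarith
  have := discrim_le_zero key
  simp only [discrim] at this
  linarith

theorem one_le_lorentz (p q : HyperbolicSpace n) : 1 ≤ lorentz p.1 q.1 := by
  have hp := time_sq p
  have hq := time_sq q
  have h1 := p.2.1
  have h2 := q.2.1
  have h := real_inner_le_norm p.1.1 q.1.1
  have h3 : ‖p.1.1‖ * ‖q.1.1‖ ≤ p.1.2 * q.1.2 - 1 := by
    apply abs_le_of_sq_le_sq' _ (by nlinarith) |>.2
    have e1 : ‖p.1.1‖ ^ 2 = p.1.2 ^ 2 - 1 := by linarith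
    have e2 : ‖q.1.1‖ ^ 2 = q.1.2 ^ 2 - 1 := by linarith
    rw [mul_pow, e1, e2]
    nlinarith [sq_nonneg (p.1.2 - q.1.2)]
  simp only [lorentz]
  linarith

/-- The geodesic distance of the hyperboloid model, `cosh d(x, y) = 𝓑(x, y)`; along a geodesic
`t ↦ cosh t • z + sinh t • u` (with `u` a unit tangent vector at `z`) it gives `d(x, z) = |t|`. -/
noncomputable instance : Dist (HyperbolicSpace n) :=
  ⟨fun p q => Real.arcosh (lorentz p.1 q.1)⟩

theorem dist_def (p q : HyperbolicSpace n) : dist p q = Real.arcosh (lorentz p.1 q.1) := rfl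

theorem cosh_dist (p q : HyperbolicSpace n) : Real.cosh (dist p q) = lorentz p.1 q.1 :=
  Real.cosh_arcosh (one_le_lorentz p q)

theorem dist_nonneg_aux (p q : HyperbolicSpace n) : 0 ≤ dist p q :=
  Real.arcosh_nonneg (one_le_lorentz p q)

theorem dist_triangle_aux (p q r : HyperbolicSpace n) : dist p r ≤ dist p q + dist q r := by
  rw [← abs_of_nonneg (dist_nonneg_aux p r),
    ← abs_of_nonneg (add_nonneg (dist_nonneg_aux p q) (dist_nonneg_aux q r)),
    ← Real.cosh_le_cosh, Real.cosh_add, cosh_dist, cosh_dist, cosh_dist]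
  have hs1 : Real.sinh (dist p q) ^ 2 = lorentz p.1 q.1 ^ 2 - 1 := by
    rw [Real.sinh_sq, cosh_dist]
  have hs2 : Real.sinh (dist q r) ^ 2 = lorentz q.1 r.1 ^ 2 - 1 := by
    rw [Real.sinh_sq, cosh_dist]
  have hn1 : 0 ≤ Real.sinh (dist p q) := Real.sinh_nonneg_iff.2 (dist_nonneg_aux p q)
  have hn2 : 0 ≤ Real.sinh (dist q r) := Real.sinh_nonneg_iff.2 (dist_nonneg_aux q r)
  have hpp := p.2.2
  have hqq := q.2.2
  have hrr := r.2.2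
  have hcs := tangent_cauchy_schwarz q (p.1 + (-lorentz p.1 q.1) • q.1)
    (r.1 + (-lorentz q.1 r.1) • q.1)
    (by rw [lorentz_add_smul, hqq]; ring)
    (by rw [lorentz_add_smul, hqq, lorentz_comm r.1]; ring)
  have e : ∀ a b : EuclideanSpace ℝ (Fin n) × ℝ, ∀ s t : ℝ,
      lorentz (a + s • q.1) (b + t • q.1)
        = lorentz a b + t * lorentz a q.1 + s * lorentz q.1 b + s * t := by
    intro a b s t
    rw [lorentz_add_smul, lorentz_comm a, lorentz_comm q.1, lorentz_add_smul,
      lorentz_add_smul, hqq, lorentz_comm b a, lorentz_comm b q.1, lorentz_comm a q.1]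
    ring
  rw [e, e, e, hpp, hrr, lorentz_comm r.1 q.1, lorentz_comm q.1 p.1] at hcs
  have h : (lorentz p.1 r.1 - lorentz p.1 q.1 * lorentz q.1 r.1) ^ 2
      ≤ (Real.sinh (dist p q) * Real.sinh (dist q r)) ^ 2 := by
    rw [mul_pow, hs1, hs2]
    nlinarith
  have := (abs_le_of_sq_le_sq' h (by positivity)).2
  linarith

theorem eq_of_dist_aux {p q : HyperbolicSpace n} (h : dist p q = 0) : p = q := by
  have h1 : lorentz p.1 q.1 = 1 := by rw [← cosh_dist, h, Real.cosh_zero]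
  have hu : lorentz (q.1 + (-1 : ℝ) • p.1) p.1 = 0 := by
    rw [lorentz_add_smul, p.2.2, lorentz_comm, h1]; ring
  have h2 : lorentz (q.1 + (-1 : ℝ) • p.1) (q.1 + (-1 : ℝ) • p.1) = 0 := by
    rw [lorentz_add_smul, lorentz_comm q.1, lorentz_comm p.1, lorentz_add_smul,
      lorentz_add_smul, q.2.2, p.2.2, lorentz_comm q.1, h1]; ring
  have hb := tangent_bound p _ hu
  set u := q.1 + (-1 : ℝ) • p.1 with hu_def
  simp only [lorentz, real_inner_self_eq_norm_sq] at h2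
  have h3 : u.2 = 0 := by
    have : u.2 ^ 2 ≤ 0 := by nlinarith
    exact pow_eq_zero_iff (two_ne_zero) |>.1 (le_antisymm this (sq_nonneg _))
  have h4 : u.1 = 0 := by
    have : ‖u.1‖ ^ 2 = 0 := by rw [h3] at h2; linarith
    exact norm_eq_zero.1 (pow_eq_zero_iff (two_ne_zero) |>.1 this)
  have h5 : u = 0 := Prod.ext h4 h3
  apply Subtype.ext
  have : q.1 = p.1 := by
    rw [hu_def, neg_one_smul, ← sub_eq_add_neg, sub_eq_zero] at h5; exact h5
  exact this.symm

noncomputable instance : MetricSpace (HyperbolicSpace n) where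
  dist_self p := by rw [dist_def, p.2.2, Real.arcosh_zero]
  dist_comm p q := by rw [dist_def, dist_def, lorentz_comm]
  dist_triangle := dist_triangle_aux
  eq_of_dist_eq_zero := eq_of_dist_aux

noncomputable instance : MeasurableSpace (HyperbolicSpace n) := borel _

instance : BorelSpace (HyperbolicSpace n) := ⟨rfl⟩

/-- The global parametrization `x ↦ x + √(1 + |x|²) e` of the hyperboloid, as a map into
`ℝⁿ × ℝ`. -/
noncomputable def graph (x : EuclideanSpace ℝ (Fin n)) : EuclideanSpace ℝ (Fin n) × ℝ :=
  (x, √(1 + ‖x‖ ^ 2))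

/-- The global parametrization `x ↦ x + √(1 + |x|²) e` of hyperbolic space. -/
noncomputable def param (x : EuclideanSpace ℝ (Fin n)) : HyperbolicSpace n :=
  ⟨graph x, by
    constructor
    · exact Real.one_le_sqrt.2 (by nlinarith [sq_nonneg ‖x‖])
    · simp only [graph, lorentz, real_inner_self_eq_norm_sq]
      rw [Real.mul_self_sqrt (by positivity)]; ring⟩

/-- The Riemannian volume density `√(det gᵢⱼ)` in the global parametrization, where
`gᵢⱼ = -𝓑(∂ᵢ, ∂ⱼ)` is the metric that `-𝓑` induces on the tangent spaces. -/
noncomputable def volumeDensity (x : EuclideanSpace ℝ (Fin n)) : ℝ :=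
  √(Matrix.det (Matrix.of fun i j : Fin n =>
    -lorentz (fderiv ℝ graph x (EuclideanSpace.single i 1))
      (fderiv ℝ graph x (EuclideanSpace.single j 1))))

/-- The `n`-dimensional (Riemannian) volume on hyperbolic space. -/
noncomputable instance : MeasureSpace (HyperbolicSpace n) where
  volume := Measure.map param
    (volume.withDensity fun x => ENNReal.ofReal (volumeDensity x))

theorem param_bijective : Function.Bijective (param (n := n)) := by
  constructor
  · intro x y h
    exact congrArg (fun p : HyperbolicSpace n => p.1.1) h
  · intro p
    refine ⟨p.1.1, Subtype.ext (Prod.ext rfl ?_)⟩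
    change √(1 + ‖p.1.1‖ ^ 2) = p.1.2
    rw [← time_sq, Real.sqrt_sq (by linarith [p.2.1])]

theorem continuous_param : Continuous (param (n := n)) := by
  have h : Continuous fun z : EuclideanSpace ℝ (Fin n) × EuclideanSpace ℝ (Fin n) =>
      dist (param z.1) (param z.2) := by
    simp only [dist_def]
    refine Real.continuousOn_arcosh.comp_continuous ?_ (fun z => one_le_lorentz _ _)
    simp only [lorentz, param, graph]
    fun_prop
  rw [continuous_iff_continuousAt]
  intro x
  rw [ContinuousAt, tendsto_iff_dist_tendsto_zero]
  have := (h.comp (Continuous.prodMk continuous_id (continuous_const (y := x)))).tendsto x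
  have h0 : dist (param x) (param x) = 0 := by simp
  simpa [h0, Function.comp_def] using this

/-- The parametrization is Borel measurable, so that the volume is a genuine image measure. -/
theorem measurable_param : Measurable (param (n := n)) := continuous_param.measurable

theorem hasFDerivAt_graph (x : EuclideanSpace ℝ (Fin n)) :
    HasFDerivAt graph ((ContinuousLinearMap.id ℝ (EuclideanSpace ℝ (Fin n))).prod
      ((√(1 + ‖x‖ ^ 2))⁻¹ • innerSL ℝ x)) x := by
  have h1 : HasFDerivAt (fun y : EuclideanSpace ℝ (Fin n) => 1 + ‖y‖ ^ 2)
      (2 • (innerSL ℝ x)) x := (HasStrictFDerivAt.hasFDerivAt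
        (hasStrictFDerivAt_norm_sq x)).const_add 1
  have h2 := h1.sqrt (by positivity)
  have h3 := (hasFDerivAt_id (𝕜 := ℝ) x).prodMk h2
  refine h3.congr_fderiv ?_
  ext v <;> simp
  field_simp

/-- The volume density is the familiar `1 / √(1 + |x|²)`. -/
theorem volumeDensity_eq (x : EuclideanSpace ℝ (Fin n)) :
    volumeDensity x = (√(1 + ‖x‖ ^ 2))⁻¹ := by
  have hpos : (0 : ℝ) < 1 + ‖x‖ ^ 2 := by positivity
  have hmat : (Matrix.of fun i j : Fin n =>
      -lorentz (fderiv ℝ graph x (EuclideanSpace.single i 1))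
        (fderiv ℝ graph x (EuclideanSpace.single j 1)))
      = 1 + Matrix.replicateCol Unit (fun i => -(1 + ‖x‖ ^ 2)⁻¹ * x i)
          * Matrix.replicateRow Unit (fun j => x j) := by
    ext i j
    rw [(hasFDerivAt_graph x).fderiv]
    simp [lorentz, Matrix.mul_apply, Matrix.one_apply, EuclideanSpace.inner_single_right]
    have hs : √(1 + ‖x‖ ^ 2) * √(1 + ‖x‖ ^ 2) = 1 + ‖x‖ ^ 2 := Real.mul_self_sqrt hpos.le
    have hi : (√(1 + ‖x‖ ^ 2))⁻¹ * (√(1 + ‖x‖ ^ 2))⁻¹ = (1 + ‖x‖ ^ 2)⁻¹ := by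
      rw [← mul_inv, hs]
    rw [← hi]
    simp only [eq_comm]
    ring
  rw [volumeDensity, hmat, Matrix.det_one_add_replicateCol_mul_replicateRow]
  have hx : (fun j => x j) ⬝ᵥ (fun i => -(1 + ‖x‖ ^ 2)⁻¹ * x i)
      = -(1 + ‖x‖ ^ 2)⁻¹ * ‖x‖ ^ 2 := by
    rw [EuclideanSpace.real_norm_sq_eq, dotProduct, Finset.mul_sum]
    exact Finset.sum_congr rfl fun i _ => by ring
  rw [hx, ← Real.sqrt_inv]
  congr 1
  field_simp
  ring

end HyperbolicSpace

/-! The proof uses two-point symmetrization: across the bisector of `p` and `q`, the points of `K`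
on the side of `q` whose mirror image is missing from `K` are reflected. Volume is preserved, and a
diameter bound survives because reflecting one of two points on the same side only increases their
distance (`dist_le_dist_refl`).

Inequality (`volume_le_of_isCompact`): among compact competitors, one maximizes the overlap with the
ball `B` of radius `D/2`. If its volume exceeded that of `B`, a symmetrization would move mass from
outside `B` into any hole of `B`; so there is no hole, and a point outside `B` is then too far from
the opposite side of `B`.

Equality: an extremal compact set `C` is diametrically complete, since otherwise a small ball could
be added, and so are all its symmetrizations. For boundary points `p`, `p'` with unique antipodes
`w`, `w'`, this forces the reflection exchanging `p` and `p'` to send `w` to `w'`; in the limit, the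
one exchanging `p'` and `w` sends `w'` to `p`. Linear algebra in the ambient space then puts `p'` on
the sphere with diameter `pw` (`lorentz_add_lorentz_eq`). Such points are dense in the boundary, so
`C` is a ball. -/

namespace HyperbolicSpace

open Metric Set Filter Topology

variable {n : ℕ}

/-! ### The Lorentzian form, distances and geodesics -/

section Form

variable (u v w : EuclideanSpace ℝ (Fin n) × ℝ) (s : ℝ)

theorem lorentz_add_left : lorentz (u + v) w = lorentz u w + lorentz v w := by
  simp [lorentz, inner_add_left]; ring

theorem lorentz_smul_left : lorentz (s • u) w = s * lorentz u w := by
  simp [lorentz, inner_smul_left]; ring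

theorem lorentz_add_right : lorentz u (v + w) = lorentz u v + lorentz u w := by
  simp [lorentz, inner_add_right]; ring

theorem lorentz_smul_right : lorentz u (s • v) = s * lorentz u v := by
  simp [lorentz, inner_smul_right]; ring

theorem lorentz_sub_left : lorentz (u - v) w = lorentz u w - lorentz v w := by
  simp [lorentz, inner_sub_left]; ring

theorem lorentz_sub_right : lorentz u (v - w) = lorentz u v - lorentz u w := by
  simp [lorentz, inner_sub_right]; ring

end Form

/-- By Cauchy–Schwarz, a unit timelike vector on the lower sheet has nonpositive product with every
point of the upper sheet. This recognizes ambient vectors as points of the space. -/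
theorem one_le_time {u : EuclideanSpace ℝ (Fin n) × ℝ} (hu : lorentz u u = 1)
    {p : HyperbolicSpace n} (hp : 0 < lorentz u p.1) : 1 ≤ u.2 := by
  have h1 : u.2 ^ 2 = 1 + ‖u.1‖ ^ 2 := by
    simp only [lorentz, real_inner_self_eq_norm_sq] at hu; linarith
  have h2 := time_sq p
  have h3 := p.2.1
  have h4 := (abs_le.1 (abs_real_inner_le_norm u.1 p.1.1)).1
  simp only [lorentz] at hp
  by_contra! h
  have h5 : u.2 < 0 := by
    by_contra! h0
    nlinarith [sq_nonneg ‖u.1‖]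
  have h6 : ‖u.1‖ ≤ -u.2 := abs_le_of_sq_le_sq' (by nlinarith) (by linarith) |>.2
  have h7 : ‖p.1.1‖ ≤ p.1.2 := abs_le_of_sq_le_sq' (by nlinarith) (by linarith) |>.2
  nlinarith [mul_le_mul h6 h7 (norm_nonneg _) (by linarith)]

theorem exists_eq_of_lorentz {u : EuclideanSpace ℝ (Fin n) × ℝ} (hu : lorentz u u = 1)
    {p : HyperbolicSpace n} (hp : 0 < lorentz u p.1) : ∃ x : HyperbolicSpace n, x.1 = u :=
  ⟨⟨u, one_le_time hu hp, hu⟩, rfl⟩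

theorem lorentz_self (p : HyperbolicSpace n) : lorentz p.1 p.1 = 1 := p.2.2

theorem lorentz_pos (p q : HyperbolicSpace n) : 0 < lorentz p.1 q.1 :=
  zero_lt_one.trans_le (one_le_lorentz p q)

theorem dist_le_iff {p q : HyperbolicSpace n} {r : ℝ} (hr : 0 ≤ r) :
    dist p q ≤ r ↔ lorentz p.1 q.1 ≤ Real.cosh r := by
  rw [← cosh_dist, Real.cosh_le_cosh, abs_of_nonneg dist_nonneg, abs_of_nonneg hr]

theorem dist_lt_iff {p q : HyperbolicSpace n} {r : ℝ} (hr : 0 ≤ r) :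
    dist p q < r ↔ lorentz p.1 q.1 < Real.cosh r := by
  rw [← cosh_dist, Real.cosh_lt_cosh, abs_of_nonneg dist_nonneg, abs_of_nonneg hr]

theorem dist_eq_iff {p q : HyperbolicSpace n} {r : ℝ} (hr : 0 ≤ r) :
    dist p q = r ↔ lorentz p.1 q.1 = Real.cosh r := by
  refine ⟨fun h => by rw [← cosh_dist, h], fun h => ?_⟩
  rw [dist_def, h, Real.arcosh_cosh hr]

theorem dist_le_dist_iff {p q p' q' : HyperbolicSpace n} :
    dist p q ≤ dist p' q' ↔ lorentz p.1 q.1 ≤ lorentz p'.1 q'.1 := by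
  rw [dist_le_iff dist_nonneg, cosh_dist]

theorem dist_eq_dist_iff {p q p' q' : HyperbolicSpace n} :
    dist p q = dist p' q' ↔ lorentz p.1 q.1 = lorentz p'.1 q'.1 := by
  rw [dist_eq_iff dist_nonneg, cosh_dist]

theorem one_lt_lorentz {p q : HyperbolicSpace n} (h : p ≠ q) : 1 < lorentz p.1 q.1 := by
  rw [← cosh_dist, Real.one_lt_cosh]
  exact (dist_pos.2 h).ne'

theorem eq_of_lorentz_eq_one {p q : HyperbolicSpace n} (h : lorentz p.1 q.1 = 1) : p = q := by
  by_contra hne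
  exact (one_lt_lorentz hne).ne' h

theorem continuous_lorentz :
    Continuous fun z : HyperbolicSpace n × HyperbolicSpace n => lorentz z.1.1 z.2.1 := by
  simp only [← cosh_dist]
  fun_prop

/-- Strict convexity of the distance functions, in coordinates. -/
theorem dist_lt_of_eq_add {p x q c : HyperbolicSpace n} {a b D : ℝ} (ha : 0 < a) (hb : 0 < b)
    (hp : p.1 = a • x.1 + b • q.1) (hxq : x ≠ q) (hx : dist x c ≤ D) (hq : dist q c ≤ D) :
    dist p c < D := by
  have hD : 0 ≤ D := dist_nonneg.trans hx
  rw [dist_le_iff hD] at hx hq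
  rw [dist_lt_iff hD]
  have h1 := lorentz_self p
  rw [hp, lorentz_add_left, lorentz_smul_left, lorentz_smul_left, lorentz_add_right,
    lorentz_add_right, lorentz_smul_right, lorentz_smul_right, lorentz_smul_right,
    lorentz_smul_right, lorentz_self, lorentz_self, lorentz_comm q.1 x.1] at h1
  have h2 := one_lt_lorentz hxq
  -- Expanding the norm of `p` gives `1 = a² + b² + 2ab 𝓑(x, q) > (a + b)²`; this is the source of
  -- strictness.
  have h3 : a + b < 1 := by
    by_contra! h
    nlinarith [mul_pos ha hb, mul_lt_mul_of_pos_left h2 (mul_pos ha hb)]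
  rw [hp, lorentz_add_left, lorentz_smul_left, lorentz_smul_left]
  nlinarith [Real.cosh_pos D]

/-- A point on a geodesic segment, expressed through the end points. -/
theorem eq_of_dist_add_dist {a x b : HyperbolicSpace n} (hab : a ≠ b)
    (h : dist a x + dist x b = dist a b) :
    x.1 = (Real.sinh (dist x b) / Real.sinh (dist a b)) • a.1
      + (Real.sinh (dist a x) / Real.sinh (dist a b)) • b.1 := by
  have hpos : 0 < Real.sinh (dist a b) := Real.sinh_pos_iff.2 (dist_pos.2 hab)
  have hne := hpos.ne'
  have hc1 := Real.cosh_sq (dist a x)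
  have hc2 := Real.cosh_sq (dist x b)
  have hs := Real.sinh_add (dist a x) (dist x b)
  have hc := Real.cosh_add (dist a x) (dist x b)
  rw [h] at hs hc
  set S := Real.sinh (dist a b)
  set s := Real.sinh (dist a x)
  set t := Real.sinh (dist x b)
  -- The combination turns out to be a point of the hyperboloid whose product with `x` is 1, so it
  -- is `x`.
  have hxu : lorentz ((t / S) • a.1 + (s / S) • b.1) x.1 = 1 := by
    rw [lorentz_add_left, lorentz_smul_left, lorentz_smul_left, ← cosh_dist a x,
      lorentz_comm b.1, ← cosh_dist x b]
    field_simp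
    rw [hs]; ring
  obtain ⟨y, hy⟩ := exists_eq_of_lorentz (u := (t / S) • a.1 + (s / S) • b.1) (p := x) (by
    rw [lorentz_add_left, lorentz_smul_left, lorentz_smul_left, lorentz_add_right,
      lorentz_add_right, lorentz_smul_right, lorentz_smul_right, lorentz_smul_right,
      lorentz_smul_right, lorentz_self, lorentz_self, lorentz_comm b.1 a.1, ← cosh_dist a b, hc]
    field_simp
    rw [hs]
    linear_combination (-t ^ 2) * hc1 - s ^ 2 * hc2) (by rw [hxu]; exact one_pos)
  rw [← hy] at hxu ⊢
  rw [eq_of_lorentz_eq_one hxu]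

/-- The geodesic line through two points. -/
theorem exists_geodesic {a b : HyperbolicSpace n} (hab : a ≠ b) :
    ∃ γ : ℝ → HyperbolicSpace n, γ 0 = a ∧ γ (dist a b) = b ∧
      ∀ s t, dist (γ s) (γ t) = |s - t| := by
  have hpos : 0 < Real.sinh (dist a b) := Real.sinh_pos_iff.2 (dist_pos.2 hab)
  have hne := hpos.ne'
  have hsq := Real.cosh_sq (dist a b)
  -- The unit tangent vector at `a` pointing towards `b`.
  obtain ⟨u, hu⟩ : ∃ u, u = (Real.sinh (dist a b))⁻¹ • (b.1 - Real.cosh (dist a b) • a.1) :=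
    ⟨_, rfl⟩
  have hau : lorentz a.1 u = 0 := by
    rw [hu, lorentz_smul_right, lorentz_sub_right, lorentz_smul_right, lorentz_self, ← cosh_dist]
    ring
  have huu : lorentz u u = -1 := by
    rw [hu, lorentz_smul_right, lorentz_sub_right, lorentz_smul_right, lorentz_smul_left,
      lorentz_smul_left, lorentz_sub_left, lorentz_sub_left, lorentz_smul_left, lorentz_smul_left,
      lorentz_self, lorentz_self, lorentz_comm b.1 a.1, ← cosh_dist]
    field_simp
    linarith
  have key : ∀ s t : ℝ, lorentz (Real.cosh s • a.1 + Real.sinh s • u)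
      (Real.cosh t • a.1 + Real.sinh t • u) = Real.cosh (s - t) := by
    intro s t
    rw [lorentz_add_left, lorentz_smul_left, lorentz_smul_left, lorentz_add_right,
      lorentz_add_right, lorentz_smul_right, lorentz_smul_right, lorentz_smul_right,
      lorentz_smul_right, lorentz_self, lorentz_comm u a.1, hau, huu, Real.cosh_sub]
    ring
  have h0 : Real.cosh 0 • a.1 + Real.sinh 0 • u = a.1 := by simp
  have hex : ∀ t : ℝ, ∃ x : HyperbolicSpace n, x.1 = Real.cosh t • a.1 + Real.sinh t • u := by
    intro t
    apply exists_eq_of_lorentz (p := a)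
    · rw [key, sub_self, Real.cosh_zero]
    · have := key t 0
      rw [h0] at this
      rw [this]; exact Real.cosh_pos _
  choose γ hγ using hex
  refine ⟨γ, Subtype.ext ?_, Subtype.ext ?_, fun s t => ?_⟩
  · rw [hγ, h0]
  · rw [hγ, hu, smul_smul, mul_inv_cancel₀ hne]; simp
  · rw [dist_eq_iff (abs_nonneg _), hγ, hγ, key, Real.cosh_abs]

theorem exists_dist_eq_add {a b : HyperbolicSpace n} (hab : a ≠ b) {t : ℝ} (ht : 0 ≤ t) :
    ∃ x, dist b x = t ∧ dist a x = dist a b + t := by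
  obtain ⟨γ, h0, h1, h⟩ := exists_geodesic hab
  refine ⟨γ (dist a b + t), ?_, ?_⟩
  · nth_rw 1 [← h1]
    rw [h, abs_sub_comm, add_sub_cancel_left, abs_of_nonneg ht]
  · nth_rw 1 [← h0]
    rw [h, zero_sub, abs_neg, abs_of_nonneg (by positivity)]

theorem exists_dist_eq_sub {a b : HyperbolicSpace n} (hab : a ≠ b) {t : ℝ} (ht : 0 ≤ t)
    (ht' : t ≤ dist a b) : ∃ x, dist a x = t ∧ dist x b = dist a b - t := by
  obtain ⟨γ, h0, h1, h⟩ := exists_geodesic hab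
  refine ⟨γ t, ?_, ?_⟩
  · nth_rw 1 [← h0]
    rw [h, zero_sub, abs_neg, abs_of_nonneg ht]
  · nth_rw 1 [← h1]
    rw [h, abs_sub_comm, abs_of_nonneg (by linarith)]

/-- Strict convexity of the distance functions. -/
theorem dist_lt_of_between {a x b c : HyperbolicSpace n} {D : ℝ} (hax : a ≠ x) (hxb : x ≠ b)
    (h : dist a x + dist x b = dist a b) (ha : dist a c ≤ D) (hb : dist b c ≤ D) :
    dist x c < D := by
  have h1 := dist_pos.2 hax
  have h2 := dist_pos.2 hxb
  have hab : a ≠ b := by rw [← dist_pos]; linarith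
  have h3 := dist_pos.2 hab
  have hs := Real.sinh_pos_iff.2 h1
  have ht := Real.sinh_pos_iff.2 h2
  have hS := Real.sinh_pos_iff.2 h3
  exact dist_lt_of_eq_add (by positivity) (by positivity) (eq_of_dist_add_dist hab h) hab ha hb

/-! ### Reflections -/

/-- The reflection in the bisector of `p` and `q`, as a map of the ambient space. -/
noncomputable def reflVec (p q u : EuclideanSpace ℝ (Fin n) × ℝ) :
    EuclideanSpace ℝ (Fin n) × ℝ :=
  u + ((lorentz u p - lorentz u q) / (lorentz p q - 1)) • (p - q)

theorem lorentz_reflVec {p q : HyperbolicSpace n}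
    (u v : EuclideanSpace ℝ (Fin n) × ℝ) :
    lorentz (reflVec p.1 q.1 u) v = lorentz u v +
      (lorentz u p.1 - lorentz u q.1) / (lorentz p.1 q.1 - 1) *
        (lorentz v p.1 - lorentz v q.1) := by
  rw [reflVec, lorentz_add_left, lorentz_smul_left, lorentz_sub_left, lorentz_comm v p.1,
    lorentz_comm v q.1]

/-- With `e = p - q` one has `𝓑(e, e) = 2(1 - 𝓑(p, q))`, so `reflVec` is the usual orthogonal
reflection `u - 2 𝓑(u, e)/𝓑(e, e) e`. -/
theorem lorentz_reflVec_reflVec {p q : HyperbolicSpace n} (h : p ≠ q)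
    (u v : EuclideanSpace ℝ (Fin n) × ℝ) :
    lorentz (reflVec p.1 q.1 u) (reflVec p.1 q.1 v) = lorentz u v := by
  have h1 : lorentz p.1 q.1 - 1 ≠ 0 := by have := one_lt_lorentz h; linarith
  rw [lorentz_reflVec, lorentz_reflVec, lorentz_reflVec, lorentz_comm u (reflVec _ _ _),
    lorentz_reflVec, lorentz_self, lorentz_self, lorentz_comm q.1 p.1, lorentz_comm v u]
  field_simp
  ring

theorem reflVec_self {p q : HyperbolicSpace n} (h : p ≠ q) : reflVec p.1 q.1 p.1 = q.1 := by
  have h1 : lorentz p.1 q.1 - 1 ≠ 0 := by have := one_lt_lorentz h; linarith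
  have h2 : (1 - lorentz p.1 q.1) / (lorentz p.1 q.1 - 1) = -1 := by field_simp; ring
  rw [reflVec, lorentz_self, h2]
  simp

open Classical in
/-- The reflection in the bisector of `p` and `q`. -/
noncomputable def refl (p q x : HyperbolicSpace n) : HyperbolicSpace n :=
  if h : p ≠ q then
    -- The upper sheet is preserved because the product of the image of `x` with `q`, the image of
    -- `p`, equals `𝓑(x, p) > 0`.
    ⟨reflVec p.1 q.1 x.1, one_le_time (p := q) (by
      rw [lorentz_reflVec_reflVec h, lorentz_self]) (by
      nth_rw 2 [← reflVec_self h]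
      rw [lorentz_reflVec_reflVec h]; exact lorentz_pos x p),
      by rw [lorentz_reflVec_reflVec h, lorentz_self]⟩
  else x

theorem refl_val {p q : HyperbolicSpace n} (h : p ≠ q) (x : HyperbolicSpace n) : (refl p q x).1 = reflVec p.1 q.1 x.1 := by
  exact congrArg Subtype.val (dif_pos h)

theorem lorentz_refl {p q : HyperbolicSpace n} (h : p ≠ q) (x y : HyperbolicSpace n) :
    lorentz (refl p q x).1 y.1 = lorentz x.1 y.1 +
      (lorentz x.1 p.1 - lorentz x.1 q.1) / (lorentz p.1 q.1 - 1) *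
        (lorentz y.1 p.1 - lorentz y.1 q.1) := by
  rw [refl_val h, lorentz_reflVec]

theorem refl_left {p q : HyperbolicSpace n} (h : p ≠ q) : refl p q p = q := Subtype.ext (by rw [refl_val h, reflVec_self h])

theorem isometry_refl {p q : HyperbolicSpace n} (h : p ≠ q) : Isometry (refl p q) := by
  refine Isometry.of_dist_eq fun x y => ?_
  rw [dist_eq_dist_iff, refl_val h, refl_val h, lorentz_reflVec_reflVec h]

theorem refl_refl {p q : HyperbolicSpace n} (h : p ≠ q) (x : HyperbolicSpace n) : refl p q (refl p q x) = x := by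
  have h1 : lorentz p.1 q.1 - 1 ≠ 0 := by have := one_lt_lorentz h; linarith
  apply eq_of_lorentz_eq_one
  rw [lorentz_refl h, lorentz_refl h, lorentz_refl h, lorentz_refl h, lorentz_self, lorentz_self,
    lorentz_self, lorentz_comm q.1 p.1]
  field_simp
  ring

theorem refl_right {p q : HyperbolicSpace n} (h : p ≠ q) : refl p q q = p := by
  have := refl_refl h p
  rwa [refl_left h] at this

theorem dist_refl_left {p q : HyperbolicSpace n} (h : p ≠ q) (x y : HyperbolicSpace n) : dist (refl p q x) y = dist x (refl p q y) := by
  rw [← (isometry_refl h).dist_eq, refl_refl h]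

theorem refl_eq_self {p q : HyperbolicSpace n} (h : p ≠ q) {x : HyperbolicSpace n} (hx : dist x p = dist x q) : refl p q x = x := by
  rw [dist_eq_dist_iff] at hx
  apply eq_of_lorentz_eq_one
  rw [lorentz_refl h, hx, lorentz_self]; simp

/-- The correction term in `lorentz_refl` is a product of two nonpositive factors, up to a positive
denominator. All monotonicity properties of the symmetrization come from here. -/
theorem dist_le_dist_refl {p q : HyperbolicSpace n} (h : p ≠ q) {x y : HyperbolicSpace n} (hx : dist x p ≤ dist x q)
    (hy : dist y p ≤ dist y q) : dist x y ≤ dist (refl p q x) y := by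
  rw [dist_le_dist_iff] at hx hy ⊢
  rw [lorentz_refl h]
  have h1 : 0 < lorentz p.1 q.1 - 1 := by have := one_lt_lorentz h; linarith
  have : 0 ≤ (lorentz x.1 p.1 - lorentz x.1 q.1) / (lorentz p.1 q.1 - 1) *
        (lorentz y.1 p.1 - lorentz y.1 q.1) :=
    mul_nonneg_of_nonpos_of_nonpos (div_nonpos_of_nonpos_of_nonneg (by linarith) h1.le)
      (by linarith)
  linarith

/-! ### Topology and volume of hyperbolic space -/

theorem lorentz_origin (x : HyperbolicSpace n) :
    lorentz x.1 (param (0 : EuclideanSpace ℝ (Fin n))).1 = √(1 + ‖x.1.1‖ ^ 2) := by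
  rw [← time_sq, Real.sqrt_sq (by linarith [x.2.1])]
  simp [lorentz, param, graph]

theorem param_fst (x : HyperbolicSpace n) : param x.1.1 = x := by
  obtain ⟨y, rfl⟩ := param_bijective.2 x
  rfl

theorem closedBall_origin_subset (r : ℝ) :
    closedBall (param (0 : EuclideanSpace ℝ (Fin n))) r ⊆ param '' closedBall 0 (Real.cosh r) := by
  intro x hx
  refine ⟨x.1.1, ?_, param_fst x⟩
  have hr : 0 ≤ r := dist_nonneg.trans hx
  rw [mem_closedBall, dist_le_iff hr, lorentz_origin] at hx
  rw [mem_closedBall_zero_iff]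
  refine le_trans (Real.le_sqrt_of_sq_le ?_) hx
  linarith

instance : ProperSpace (HyperbolicSpace n) := by
  refine ⟨fun x r => ?_⟩
  refine IsCompact.of_isClosed_subset
    ((isCompact_closedBall (0 : EuclideanSpace ℝ (Fin n)) _).image continuous_param)
    isClosed_closedBall
    ((closedBall_subset_closedBall' (y := param 0) le_rfl).trans (closedBall_origin_subset _))

theorem measurable_volumeDensity : Measurable fun x : EuclideanSpace ℝ (Fin n) =>
    ENNReal.ofReal (volumeDensity x) := by
  simp only [volumeDensity_eq]
  fun_prop

theorem volumeDensity_pos (x : EuclideanSpace ℝ (Fin n)) : 0 < volumeDensity x := by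
  rw [volumeDensity_eq]; positivity

theorem volumeDensity_le_one (x : EuclideanSpace ℝ (Fin n)) : volumeDensity x ≤ 1 := by
  rw [volumeDensity_eq]
  exact inv_le_one_of_one_le₀ (Real.one_le_sqrt.2 (by nlinarith [sq_nonneg ‖x‖]))

theorem volume_def : (volume : Measure (HyperbolicSpace n)) = Measure.map param
    (volume.withDensity fun x => ENNReal.ofReal (volumeDensity x)) := rfl

instance : IsFiniteMeasureOnCompacts (volume : Measure (HyperbolicSpace n)) := by
  refine ⟨fun K hK => ?_⟩
  obtain ⟨r, hr⟩ := hK.isBounded.subset_closedBall (param 0)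
  have hsub := hr.trans (closedBall_origin_subset r)
  rw [volume_def, Measure.map_apply measurable_param hK.measurableSet,
    withDensity_apply _ (measurable_param hK.measurableSet)]
  calc ∫⁻ x in param ⁻¹' K, ENNReal.ofReal (volumeDensity x)
      ≤ ∫⁻ x in param ⁻¹' K, 1 := lintegral_mono fun x => by
        simpa using volumeDensity_le_one x
    _ = volume (param ⁻¹' K) := by simp
    _ ≤ volume (closedBall (0 : EuclideanSpace ℝ (Fin n)) (Real.cosh r)) := by
        apply measure_mono
        intro x hx
        obtain ⟨y, hy, hyx⟩ := hsub hx
        rwa [← param_bijective.1 hyx]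
    _ < ⊤ := measure_closedBall_lt_top

instance : (volume : Measure (HyperbolicSpace n)).IsOpenPosMeasure := by
  refine ⟨fun U hU hne h0 => ?_⟩
  have hU' : IsOpen (param ⁻¹' U) := hU.preimage continuous_param
  have hne' : (param ⁻¹' U).Nonempty := hne.preimage param_bijective.2
  rw [volume_def, Measure.map_apply measurable_param hU.measurableSet,
    withDensity_apply_eq_zero measurable_volumeDensity] at h0
  refine hU'.measure_ne_zero volume hne' ?_
  convert h0 using 2
  ext x
  simp [volumeDensity_pos x]

/-! ### Reflections preserve the volume -/

/-- The coordinate expression of a reflection. -/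
noncomputable def reflCoord (p q : HyperbolicSpace n) (x : EuclideanSpace ℝ (Fin n)) :
    EuclideanSpace ℝ (Fin n) :=
  (refl p q (param x)).1.1

theorem param_reflCoord (p q : HyperbolicSpace n) (x : EuclideanSpace ℝ (Fin n)) :
    param (reflCoord p q x) = refl p q (param x) := param_fst _

theorem reflCoord_reflCoord {p q : HyperbolicSpace n} (h : p ≠ q)
    (x : EuclideanSpace ℝ (Fin n)) : reflCoord p q (reflCoord p q x) = x := by
  apply param_bijective.1
  rw [param_reflCoord, param_reflCoord, refl_refl h]

/-- The linear functional by which the coefficient of a reflection varies. -/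
noncomputable def reflSlope (p q : HyperbolicSpace n) (x : EuclideanSpace ℝ (Fin n)) :
    EuclideanSpace ℝ (Fin n) →L[ℝ] ℝ :=
  (lorentz p.1 q.1 - 1)⁻¹ • (((p.1.2 - q.1.2) * (√(1 + ‖x‖ ^ 2))⁻¹) • innerSL ℝ x
    - innerSL ℝ (p.1.1 - q.1.1))

theorem hasFDerivAt_reflCoord {p q : HyperbolicSpace n} (h : p ≠ q)
    (x : EuclideanSpace ℝ (Fin n)) :
    HasFDerivAt (reflCoord p q) (ContinuousLinearMap.id ℝ _ +
      (reflSlope p q x).smulRight (p.1.1 - q.1.1)) x := by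
  have h2 : HasFDerivAt (fun y : EuclideanSpace ℝ (Fin n) => √(1 + ‖y‖ ^ 2))
      ((√(1 + ‖x‖ ^ 2))⁻¹ • innerSL ℝ x) x := (hasFDerivAt_graph x).snd
  have h3 : HasFDerivAt (fun y => (lorentz p.1 q.1 - 1)⁻¹ *
      (√(1 + ‖y‖ ^ 2) * (p.1.2 - q.1.2) - inner ℝ (p.1.1 - q.1.1) y)) (reflSlope p q x) x := by
    refine (((h2.mul_const (p.1.2 - q.1.2)).sub
      (innerSL ℝ (p.1.1 - q.1.1)).hasFDerivAt).const_mul _).congr_fderiv ?_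
    ext v
    simp [reflSlope]
    left
    ring
  have h4 := (hasFDerivAt_id x).add (h3.smul_const (p.1.1 - q.1.1))
  refine h4.congr_of_eventuallyEq (Eventually.of_forall fun y => ?_)
  rw [reflCoord, refl_val h]
  simp only [reflVec, param, graph, lorentz]
  simp [inner_sub_left, real_inner_comm y]
  congr 1
  ring

/-- The derivative is a rank-one perturbation of the identity, with determinant minus the ratio of
the new time coordinate to the old one; the density is the inverse time coordinate, so the two
cancel. -/
theorem abs_det_reflCoord {p q : HyperbolicSpace n} (h : p ≠ q) (x : EuclideanSpace ℝ (Fin n)) :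
    |(ContinuousLinearMap.id ℝ _ + (reflSlope p q x).smulRight (p.1.1 - q.1.1)).det|
      * volumeDensity (reflCoord p q x) = volumeDensity x := by
  have hdet : (ContinuousLinearMap.id ℝ _ +
      (reflSlope p q x).smulRight (p.1.1 - q.1.1)).det
      = 1 + reflSlope p q x (p.1.1 - q.1.1) := by
    exact LinearMap.transvection.det (reflSlope p q x).toLinearMap (p.1.1 - q.1.1)
  have hq : 0 < lorentz p.1 q.1 - 1 := by have := one_lt_lorentz h; linarith
  have hw : 0 < √(1 + ‖x‖ ^ 2) := by positivity
  have hpp := lorentz_self p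
  have hqq := lorentz_self q
  have e2 : √(1 + ‖reflCoord p q x‖ ^ 2) = (refl p q (param x)).1.2 := by
    rw [reflCoord, ← time_sq, Real.sqrt_sq (by linarith [(refl p q (param x)).2.1])]
  have hpos : 0 < (refl p q (param x)).1.2 := by linarith [(refl p q (param x)).2.1]
  have e1 : 1 + reflSlope p q x (p.1.1 - q.1.1)
      = -((refl p q (param x)).1.2 / √(1 + ‖x‖ ^ 2)) := by
    rw [refl_val h]
    simp only [reflVec, reflSlope, param, graph]
    simp [inner_sub_right]
    simp only [lorentz, real_inner_comm p.1.1 q.1.1, real_inner_self_eq_norm_sq] at hpp hqq hq ⊢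
    field_simp
    linear_combination √(1 + ‖x‖ ^ 2) * (hpp + hqq)
  rw [hdet, volumeDensity_eq, volumeDensity_eq, e2, e1, abs_neg,
    abs_of_pos (div_pos hpos hw)]
  field_simp

theorem measurePreserving_refl {p q : HyperbolicSpace n} (h : p ≠ q) :
    MeasurePreserving (refl p q) volume volume := by
  have hm : Measurable (refl p q) := (isometry_refl h).continuous.measurable
  refine ⟨hm, Measure.ext fun A hA => ?_⟩
  have hinv : param ⁻¹' (refl p q ⁻¹' A) = reflCoord p q '' (param ⁻¹' A) := by
    ext x
    constructor
    · intro hx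
      refine ⟨reflCoord p q x, ?_, reflCoord_reflCoord h x⟩
      rwa [mem_preimage, param_reflCoord]
    · rintro ⟨y, hy, rfl⟩
      rwa [mem_preimage, mem_preimage, param_reflCoord, refl_refl h]
  have hA' : MeasurableSet (param ⁻¹' A : Set (EuclideanSpace ℝ (Fin n))) := measurable_param hA
  rw [Measure.map_apply hm hA, volume_def, Measure.map_apply measurable_param (hm hA),
    Measure.map_apply measurable_param hA, withDensity_apply _ (measurable_param (hm hA)),
    withDensity_apply _ hA', hinv,
    lintegral_image_eq_lintegral_abs_det_fderiv_mul volume hA'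
      (fun x _ => (hasFDerivAt_reflCoord h x).hasFDerivWithinAt)
      (Function.LeftInverse.injective (reflCoord_reflCoord h)).injOn]
  refine lintegral_congr fun x => ?_
  rw [← ENNReal.ofReal_mul (abs_nonneg _), abs_det_reflCoord h]

theorem volume_preimage_refl {p q : HyperbolicSpace n} (h : p ≠ q) (A : Set (HyperbolicSpace n)) :
    volume (refl p q ⁻¹' A) = volume A := by
  have hinj : Function.Injective (refl p q) := (isometry_refl h).injective
  have hsurj : Function.Surjective (refl p q) := fun x => ⟨_, refl_refl h x⟩
  have hemb : MeasurableEmbedding (refl p q) :=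
    (isometry_refl h).isClosedEmbedding.measurableEmbedding
  exact (measurePreserving_refl h).measure_preimage_emb hemb A

theorem volume_closedBall_eq (p q : HyperbolicSpace n) (r : ℝ) :
    volume (closedBall p r) = volume (closedBall q r) := by
  by_cases h : p = q
  · rw [h]
  rw [← volume_preimage_refl h]
  congr 1
  ext x
  rw [mem_preimage, mem_closedBall, dist_refl_left h, refl_left h, mem_closedBall]

/-! ### Two-point symmetrization -/

/-- The two-point symmetrization of `K` with respect to the bisector of `p` and `q`, towards `p`. -/
def twoPoint (p q : HyperbolicSpace n) (K : Set (HyperbolicSpace n)) : Set (HyperbolicSpace n) :=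
  (K ∩ refl p q ⁻¹' K) ∪ ((K ∪ refl p q ⁻¹' K) ∩ {x | dist x p ≤ dist x q})

/-- The part of `K` that is moved by the two-point symmetrization. -/
def movedPart (p q : HyperbolicSpace n) (K : Set (HyperbolicSpace n)) : Set (HyperbolicSpace n) :=
  {x | x ∈ K ∧ refl p q x ∉ K ∧ dist x q < dist x p}

theorem dist_refl_lt_iff {p q : HyperbolicSpace n} (h : p ≠ q) (x : HyperbolicSpace n) :
    dist (refl p q x) q < dist (refl p q x) p ↔ dist x p < dist x q := by
  rw [dist_refl_left h, dist_refl_left h, refl_left h, refl_right h]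

theorem isClosed_halfSpace (p q : HyperbolicSpace n) :
    IsClosed {x : HyperbolicSpace n | dist x p ≤ dist x q} :=
  isClosed_le (by fun_prop) (by fun_prop)

theorem isCompact_preimage_refl {p q : HyperbolicSpace n} (h : p ≠ q)
    {K : Set (HyperbolicSpace n)} (hK : IsCompact K) : IsCompact (refl p q ⁻¹' K) :=
  (isometry_refl h).isClosedEmbedding.isCompact_preimage hK

theorem isCompact_twoPoint {p q : HyperbolicSpace n} (h : p ≠ q)
    {K : Set (HyperbolicSpace n)} (hK : IsCompact K) : IsCompact (twoPoint p q K) :=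
  (hK.inter (isCompact_preimage_refl h hK)).union
    ((hK.union (isCompact_preimage_refl h hK)).inter_right (isClosed_halfSpace p q))

/-- If `x` and its image both lie in `K`, one of them can be paired with whichever of `y` and its
image lies in `K`. Otherwise both points are on the side of `p`, and `dist_le_dist_refl` handles the
case where only one of them comes from a reflected point. -/
theorem dist_le_of_mem_twoPoint {p q : HyperbolicSpace n} (h : p ≠ q)
    {K : Set (HyperbolicSpace n)} {D : ℝ} (hK : ∀ x ∈ K, ∀ y ∈ K, dist x y ≤ D) :
    ∀ x ∈ twoPoint p q K, ∀ y ∈ twoPoint p q K, dist x y ≤ D := by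
  have hrefl : ∀ x y, dist (refl p q x) (refl p q y) = dist x y := (isometry_refl h).dist_eq
  have both : ∀ x ∈ K ∩ refl p q ⁻¹' K, ∀ y ∈ twoPoint p q K, dist x y ≤ D := by
    rintro x ⟨hx, hx'⟩ y hy
    have : y ∈ K ∨ refl p q y ∈ K := by
      rcases hy with hy | hy
      · exact Or.inl hy.1
      · exact hy.1
    rcases this with hy | hy
    · exact hK x hx y hy
    · rw [← hrefl]; exact hK _ hx' _ hy
  intro x hx y hy
  rcases hx with hx | ⟨hx, hxP⟩
  · exact both x hx y hy
  rcases hy with hy | ⟨hy, hyP⟩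
  · rw [dist_comm]; exact both y hy x (Or.inr ⟨hx, hxP⟩)
  have key := dist_le_dist_refl h hxP hyP
  rcases hx with hx | hx <;> rcases hy with hy | hy
  · exact hK x hx y hy
  · rw [dist_refl_left h] at key
    exact key.trans (hK _ hx _ hy)
  · exact key.trans (hK _ hx _ hy)
  · rw [← hrefl]; exact hK _ hx _ hy

theorem twoPoint_subset_closedBall {p q z : HyperbolicSpace n} (h : p ≠ q)
    {K : Set (HyperbolicSpace n)} {R : ℝ} (hz : dist z p ≤ dist z q) (hK : K ⊆ closedBall z R) :
    twoPoint p q K ⊆ closedBall z R := by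
  rintro x (hx | ⟨hx | hx, hxP⟩)
  · exact hK hx.1
  · exact hK hx
  · exact (dist_le_dist_refl h hxP hz).trans (hK hx)

/-- This form makes the volume computable. The strict inequality in `movedPart` loses nothing, since
the reflection fixes the bisector. -/
theorem twoPoint_eq {p q : HyperbolicSpace n} (h : p ≠ q) (K : Set (HyperbolicSpace n)) :
    twoPoint p q K = (K \ movedPart p q K) ∪ refl p q ⁻¹' movedPart p q K := by
  ext x
  simp only [twoPoint, movedPart, mem_union, mem_inter_iff, mem_preimage, Set.mem_sdiff, mem_ofPred_eq,
    refl_refl h, dist_refl_lt_iff h]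
  have hself : dist x p = dist x q → refl p q x = x := refl_eq_self h
  constructor
  · rintro (⟨h1, h2⟩ | ⟨h1, h2⟩)
    · tauto
    · by_cases hx : x ∈ K
      · exact Or.inl ⟨hx, fun h3 => h3.2.2.not_ge h2⟩
      · refine Or.inr ⟨h1.resolve_left hx, hx, lt_of_le_of_ne h2 fun h3 => ?_⟩
        rw [hself h3] at h1
        tauto
  · rintro (⟨h1, h2⟩ | ⟨h1, h2, h3⟩)
    · by_cases h3 : dist x p ≤ dist x q
      · tauto
      · have := not_le.1 h3
        tauto
    · exact Or.inr ⟨Or.inr h1, h3.le⟩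

theorem movedPart_subset (p q : HyperbolicSpace n) (K : Set (HyperbolicSpace n)) :
    movedPart p q K ⊆ K := fun _ hx => hx.1

theorem measurableSet_movedPart {p q : HyperbolicSpace n} (h : p ≠ q)
    {K : Set (HyperbolicSpace n)} (hK : MeasurableSet K) : MeasurableSet (movedPart p q K) := by
  have h1 := (measurePreserving_refl h).measurable hK
  have h2 : MeasurableSet {x : HyperbolicSpace n | dist x q < dist x p} :=
    (isOpen_lt (by fun_prop) (by fun_prop)).measurableSet
  exact hK.inter (h1.compl.inter h2)

theorem volume_twoPoint {p q : HyperbolicSpace n} (h : p ≠ q)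
    {K : Set (HyperbolicSpace n)} (hK : MeasurableSet K) :
    volume (twoPoint p q K) = volume K := by
  have hA := measurableSet_movedPart h hK
  rw [twoPoint_eq h, measure_union _ ((measurePreserving_refl h).measurable hA),
    volume_preimage_refl h, add_comm]
  · conv_rhs => rw [← measure_inter_add_sdiff K hA,
      inter_eq_right.2 (movedPart_subset p q K)]
  · rw [disjoint_left]
    rintro x hx ⟨-, hx', -⟩
    rw [refl_refl h] at hx'
    exact hx' hx.1

/-- Two-point symmetrization towards the half space of `z` increases the volume of the
intersection with balls around `z`. -/
theorem volume_inter_closedBall_add_le {p q z : HyperbolicSpace n} (h : p ≠ q)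
    {K : Set (HyperbolicSpace n)} (hK : MeasurableSet K) (hz : dist z p ≤ dist z q) (r : ℝ) :
    volume (K ∩ closedBall z r) +
      volume (refl p q ⁻¹' (movedPart p q K \ closedBall z r) ∩ closedBall z r)
      ≤ volume (twoPoint p q K ∩ closedBall z r) := by
  have hA := measurableSet_movedPart h hK
  have hB : MeasurableSet (closedBall z r) := measurableSet_closedBall
  have hσ := (measurePreserving_refl h).measurable
  set A := movedPart p q K with hAdef
  set B := closedBall z r
  -- The moved points inside `B` stay in `B` after reflection, as they come closer to `z`. The extra
  -- term counts the moved points that enter `B` from outside.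
  have e1 : volume (K ∩ B) = volume ((K \ A) ∩ B) + volume (refl p q ⁻¹' (A ∩ B)) := by
    rw [volume_preimage_refl h, ← measure_inter_add_sdiff (K ∩ B) hA, add_comm]
    congr 2
    · ext x; simp; tauto
    · ext x
      have := @movedPart_subset _ p q K x
      simp only [mem_inter_iff]; tauto
  have hdisj1 : Disjoint (refl p q ⁻¹' (A ∩ B)) (refl p q ⁻¹' (A \ B) ∩ B) := by
    rw [disjoint_left]
    rintro x hx ⟨hx', -⟩
    exact hx'.2 hx.2
  have hdisj2 : Disjoint ((K \ A) ∩ B) (refl p q ⁻¹' (A ∩ B) ∪ refl p q ⁻¹' (A \ B) ∩ B) := by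
    rw [disjoint_left]
    rintro x ⟨⟨hx, -⟩, -⟩ hx'
    have : refl p q x ∈ A := by
      rcases hx' with hx' | hx'
      · exact hx'.1
      · exact hx'.1.1
    have := this.2.1
    rw [refl_refl h] at this
    exact this hx
  rw [e1, add_assoc, ← measure_union hdisj1 ((hσ (hA.diff hB)).inter hB),
    ← measure_union hdisj2 ((hσ (hA.inter hB)).union ((hσ (hA.diff hB)).inter hB))]
  apply measure_mono
  rw [twoPoint_eq h]
  rintro x (⟨hx, hxB⟩ | ⟨hx, hxB⟩ | ⟨hx, hxB⟩)
  · exact ⟨Or.inl hx, hxB⟩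
  · refine ⟨Or.inr hx, ?_⟩
    have h1 := (dist_refl_lt_iff h x).1 hx.2.2
    exact (dist_le_dist_refl h h1.le hz).trans hxB
  · exact ⟨Or.inr hx.1, hxB⟩

/-! ### The isodiametric inequality -/

/-- By outer regularity `K ∩ B` has an open neighbourhood `U` of nearly the same volume, and `L ⊆ U
∪ Bᶜ` is an open condition on `L`. -/
theorem upperSemicontinuous_volume_inter {B : Set (HyperbolicSpace n)} (hB : IsClosed B) :
    UpperSemicontinuous fun K : TopologicalSpace.Compacts (HyperbolicSpace n) =>
      volume ((K : Set (HyperbolicSpace n)) ∩ B) := by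
  intro K c hc
  obtain ⟨U, hU, hUo, hUc⟩ := Set.exists_isOpen_lt_of_lt _ _ hc
  have h1 : IsOpen (U ∪ Bᶜ) := hUo.union hB.isOpen_compl
  filter_upwards [(TopologicalSpace.Compacts.isOpen_subsets_of_isOpen h1).mem_nhds
    (show (K : Set (HyperbolicSpace n)) ⊆ U ∪ Bᶜ from fun x hx => by
      by_cases hxB : x ∈ B
      · exact Or.inl (hU ⟨hx, hxB⟩)
      · exact Or.inr hxB)] with L hL
  refine (measure_mono ?_).trans_lt hUc
  rintro x ⟨hx, hxB⟩
  exact (hL hx).resolve_right (fun h => h hxB)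

theorem isClosed_setOf_dist_le (D : ℝ) :
    IsClosed {K : TopologicalSpace.Compacts (HyperbolicSpace n) |
      ∀ x ∈ K, ∀ y ∈ K, dist x y ≤ D} := by
  rw [← isOpen_compl_iff, isOpen_iff_mem_nhds]
  intro K hK
  simp only [mem_compl_iff, mem_ofPred_eq, not_forall, not_le] at hK
  obtain ⟨x, hx, y, hy, hxy⟩ := hK
  have hO : IsOpen {z : HyperbolicSpace n × HyperbolicSpace n | D < dist z.1 z.2} :=
    isOpen_lt continuous_const continuous_dist
  obtain ⟨U, V, hU, hV, hxU, hyV, hUV⟩ := isOpen_prod_iff.1 hO x y hxy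
  filter_upwards [(TopologicalSpace.Compacts.isOpen_inter_nonempty_of_isOpen hU).mem_nhds
    ⟨x, hx, hxU⟩, (TopologicalSpace.Compacts.isOpen_inter_nonempty_of_isOpen hV).mem_nhds
    ⟨y, hy, hyV⟩]
  rintro L ⟨x', hx', hxU'⟩ ⟨y', hy', hyV'⟩ hL
  exact (hL x' hx' y' hy').not_gt (hUV (mk_mem_prod hxU' hyV'))

theorem volume_le_of_isCompact {C : Set (HyperbolicSpace n)} (hC : IsCompact C) {D : ℝ}
    (hD : 0 < D) (hdist : ∀ x ∈ C, ∀ y ∈ C, dist x y ≤ D) (z : HyperbolicSpace n) :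
    volume C ≤ volume (closedBall z (D / 2)) := by
  by_contra! hlt
  set B := closedBall z (D / 2)
  obtain ⟨R, hR⟩ := hC.isBounded.subset_closedBall z
  -- The competitors form a compact family: the large ball gives compactness, and the lower bound on
  -- volume keeps them larger than `B`. The quantity maximized is the overlap with `B`, not the
  -- volume.
  let F : Set (TopologicalSpace.Compacts (HyperbolicSpace n)) :=
    {K | (K : Set (HyperbolicSpace n)) ⊆ closedBall z R} ∩
      ({K | ∀ x ∈ K, ∀ y ∈ K, dist x y ≤ D} ∩
        {K | volume C ≤ volume (K : Set (HyperbolicSpace n))})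
  have hF : IsCompact F := by
    refine (TopologicalSpace.Compacts.isCompact_subsets_of_isCompact
      (isCompact_closedBall z R)).inter_right ((isClosed_setOf_dist_le D).inter ?_)
    have := (upperSemicontinuous_volume_inter (n := n) isClosed_univ).isClosed_preimage (volume C)
    simpa [preimage, Ici] using this
  have hne : F.Nonempty := ⟨⟨C, hC⟩, hR, hdist, le_refl (volume C)⟩
  obtain ⟨K, ⟨hKR, hKD, hKV⟩, hmax⟩ := UpperSemicontinuousOn.exists_isMaxOn hne hF
    ((upperSemicontinuous_volume_inter (isClosed_closedBall (x := z)
      (ε := D / 2))).upperSemicontinuousOn F)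
  have hKc : IsCompact (K : Set (HyperbolicSpace n)) := K.isCompact
  have hdiff : volume ((K : Set (HyperbolicSpace n)) \ B) ≠ 0 := by
    intro h0
    have : volume (K : Set (HyperbolicSpace n)) ≤ volume B := by
      rw [← measure_inter_add_sdiff (K : Set (HyperbolicSpace n)) measurableSet_closedBall, h0,
        add_zero]
      exact measure_mono inter_subset_right
    exact (hlt.trans_le hKV).not_ge this
  obtain ⟨x, ⟨hxK, hxB⟩, hx⟩ := exists_mem_forall_mem_nhdsWithin_pos_measure hdiff
  have hxz : D / 2 < dist x z := not_le.1 hxB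
  have hball : ball z (D / 2) ⊆ K := by
    intro y hy
    by_contra hyK
    have hyx : y ≠ x := fun h => hyK (h ▸ hxK)
    have hyz : dist z y ≤ dist z x := by
      rw [dist_comm z y, dist_comm z x]; exact hy.le.trans hxz.le
    have hlt' : dist y z < dist x z := hy.trans hxz
    let L : TopologicalSpace.Compacts (HyperbolicSpace n) :=
      ⟨twoPoint y x K, isCompact_twoPoint hyx hKc⟩
    have hL : L ∈ F := ⟨twoPoint_subset_closedBall hyx hyz hKR, dist_le_of_mem_twoPoint hyx hKD,
      hKV.trans (volume_twoPoint hyx hKc.measurableSet).ge⟩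
    have h1 := volume_inter_closedBall_add_le hyx hKc.measurableSet hyz (D / 2)
    have h2 : volume ((L : Set (HyperbolicSpace n)) ∩ B)
      ≤ volume ((K : Set (HyperbolicSpace n)) ∩ B) := hmax hL
    have hfin : volume ((K : Set (HyperbolicSpace n)) ∩ B) ≠ ⊤ :=
      ((measure_mono inter_subset_left).trans_lt hKc.measure_lt_top).ne
    -- Points of `K \ B` near `x` have positive volume, and the reflection carries them near `y`,
    -- into the part of the open ball missed by `K`.
    have hpos : 0 < volume (refl y x ⁻¹' (movedPart y x K \ B) ∩ B) := by
      have hU : IsOpen (refl y x ⁻¹' (ball z (D / 2) \ K) ∩ {w | dist w x < dist w y}) :=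
        ((isOpen_ball.sdiff hKc.isClosed).preimage (isometry_refl hyx).continuous).inter
          (isOpen_lt (by fun_prop) (by fun_prop))
      have hxU : x ∈ refl y x ⁻¹' (ball z (D / 2) \ K) ∩ {w | dist w x < dist w y} := by
        refine ⟨?_, ?_⟩
        · rw [mem_preimage, refl_right hyx]; exact ⟨hy, hyK⟩
        · simpa using hyx.symm
      refine (hx _ (inter_mem_nhdsWithin _ (hU.mem_nhds hxU))).trans_le ?_
      rw [← volume_preimage_refl hyx]
      apply measure_mono
      rintro w ⟨⟨hwK, hwB⟩, hwU, hwP⟩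
      rw [mem_preimage, refl_refl hyx] at hwU
      refine ⟨⟨⟨hwK, ?_, hwP⟩, hwB⟩, ball_subset_closedBall hwU.1⟩
      rw [refl_refl hyx]; exact hwU.2
    have h3 := ENNReal.lt_add_right hfin hpos.ne'
    exact (h3.trans_le (h1.trans h2)).false
  have hne : x ≠ z := by rw [← dist_pos]; linarith
  -- The point `y` lies beyond `z` as seen from `x`: its distance from `z` is below `D/2`, yet its
  -- distance from `x` exceeds `D`.
  obtain ⟨y, hy1, hy2⟩ := exists_dist_eq_add hne (t := max 0 (D - dist x z + (dist x z - D / 2) / 2))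
    (le_max_left _ _)
  have hyK : y ∈ (K : Set (HyperbolicSpace n)) := by
    apply hball
    rw [mem_ball, dist_comm, hy1, max_lt_iff]
    constructor <;> linarith
  have := hKD x hxK y hyK
  have h5 := le_max_right 0 (D - dist x z + (dist x z - D / 2) / 2)
  linarith

/-! ### Balls -/

theorem closedBall_subset_closure_ball (z : HyperbolicSpace n) {r : ℝ} (hr : 0 < r) :
    closedBall z r ⊆ closure (ball z r) := by
  intro x hx
  by_cases hxz : z = x
  · exact subset_closure (by rw [← hxz]; exact mem_ball_self hr)
  have hpos := dist_pos.2 hxz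
  rw [mem_closedBall, dist_comm] at hx
  rw [Metric.mem_closure_iff]
  intro ε hε
  obtain ⟨y, h1, h2⟩ := exists_dist_eq_sub hxz (t := dist z x - min (ε / 2) (dist z x / 2))
    (by have := min_le_right (ε / 2) (dist z x / 2); linarith)
    (by have : 0 < min (ε / 2) (dist z x / 2) := by positivity
        linarith)
  have h3 : 0 < min (ε / 2) (dist z x / 2) := by positivity
  have h4 := min_le_left (ε / 2) (dist z x / 2)
  refine ⟨y, ?_, ?_⟩
  · rw [mem_ball, dist_comm]; linarith
  · rw [dist_comm]; linarith

theorem isPreconnected_ball (z : HyperbolicSpace n) (r : ℝ) : IsPreconnected (ball z r) := by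
  refine isPreconnected_of_forall z fun y hy => ?_
  by_cases hyz : z = y
  · exact ⟨{z}, by simpa [hyz] using hy, by simp, by simp [hyz], isPreconnected_singleton⟩
  obtain ⟨γ, h0, h1, h⟩ := exists_geodesic hyz
  have hc : Continuous γ := (Isometry.of_dist_eq (f := γ) fun s t => by
    rw [h, Real.dist_eq]).continuous
  refine ⟨γ '' Icc 0 (dist z y), ?_, ⟨0, ⟨le_rfl, dist_nonneg⟩, h0⟩,
    ⟨_, ⟨dist_nonneg, le_rfl⟩, h1⟩, isPreconnected_Icc.image _ hc.continuousOn⟩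
  rintro _ ⟨t, ht, rfl⟩
  rw [mem_ball] at hy ⊢
  rw [← h0, h, sub_zero, abs_of_nonneg ht.1]
  rw [dist_comm] at hy
  exact ht.2.trans_lt hy

theorem exists_closedBall_dist_le {C : Set (HyperbolicSpace n)} (hC : IsCompact C)
    {x : HyperbolicSpace n} {D : ℝ} (h : ∀ c ∈ C, dist x c < D) :
    ∃ ε > 0, ∀ y ∈ closedBall x ε, ∀ c ∈ C, dist y c ≤ D := by
  rcases C.eq_empty_or_nonempty with rfl | hne
  · exact ⟨1, one_pos, by simp⟩
  obtain ⟨m, hm, hmax⟩ := hC.exists_isMaxOn hne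
    (f := fun c => dist x c) (by fun_prop)
  refine ⟨D - dist x m, sub_pos.2 (h m hm), fun y hy c hc => ?_⟩
  have h1 : dist x c ≤ dist x m := hmax hc
  have h2 := dist_triangle y x c
  rw [mem_closedBall] at hy
  linarith

/-! ### Diametrically complete sets -/

/-- A nonempty compact set of diameter at most `D` that cannot be enlarged without enlarging the
diameter beyond `D`. -/
structure IsDiametricallyComplete (D : ℝ) (C : Set (HyperbolicSpace n)) : Prop where
  isCompact : IsCompact C
  nonempty : C.Nonempty
  dist_le : ∀ x ∈ C, ∀ y ∈ C, dist x y ≤ D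
  mem_of_dist_le : ∀ x, (∀ y ∈ C, dist x y ≤ D) → x ∈ C

/-- If `p` could be added to `C`, then by strict convexity a point `x` slightly along a segment from
`p` into `C` is at distance strictly less than `D` from all of `C`. A small ball about `x` could
then be added, violating the inequality. -/
theorem isDiametricallyComplete_of_volume_eq {C : Set (HyperbolicSpace n)} (hC : IsCompact C)
    {D : ℝ} (hD : 0 < D) (hdist : ∀ x ∈ C, ∀ y ∈ C, dist x y ≤ D) {z : HyperbolicSpace n}
    (hV : volume C = volume (closedBall z (D / 2))) : IsDiametricallyComplete D C := by
  have hne : C.Nonempty := by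
    rw [nonempty_iff_ne_empty]
    rintro rfl
    rw [measure_empty] at hV
    exact (measure_closedBall_pos volume z (half_pos hD)).ne hV
  refine ⟨hC, hne, hdist, fun p hp => ?_⟩
  by_contra hpC
  obtain ⟨c, hc⟩ := hne
  have hpc : p ≠ c := fun h => hpC (h ▸ hc)
  have hpc' := dist_pos.2 hpc
  obtain ⟨δ, hδ, hδC⟩ := Metric.isOpen_iff.1 hC.isClosed.isOpen_compl p hpC
  have htpos : 0 < min (δ / 2) (dist p c / 2) := by positivity
  have ht1 := min_le_left (δ / 2) (dist p c / 2)
  have ht2 := min_le_right (δ / 2) (dist p c / 2)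
  obtain ⟨x, hx1, hx2⟩ := exists_dist_eq_sub hpc htpos.le (by linarith)
  have hpx : p ≠ x := by rw [← dist_pos, hx1]; exact htpos
  have hxc : x ≠ c := by rw [← dist_pos, hx2]; linarith
  obtain ⟨ε, hε, hεC⟩ := exists_closedBall_dist_le hC (x := x) (D := D) fun c' hc' =>
    dist_lt_of_between hpx hxc (by linarith) (hp c' hc') (hdist c hc c' hc')
  -- The three bounds keep the new ball within `D` of `C`, disjoint from `C`, and of diameter at
  -- most `D`.
  have hη : 0 < min ε (min (δ / 4) (D / 2)) := by positivity
  have hη1 := min_le_left ε (min (δ / 4) (D / 2))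
  have hη2 := (min_le_right ε (min (δ / 4) (D / 2))).trans (min_le_left _ _)
  have hη3 := (min_le_right ε (min (δ / 4) (D / 2))).trans (min_le_right _ _)
  set η := min ε (min (δ / 4) (D / 2))
  have hdisj : Disjoint C (closedBall x η) := by
    rw [disjoint_left]
    intro y hy hyx
    refine hδC ?_ hy
    rw [mem_closedBall] at hyx
    rw [mem_ball]
    have := dist_triangle y x p
    rw [dist_comm x p] at this
    linarith
  have hle := volume_le_of_isCompact (hC.union (isCompact_closedBall x η)) hD (by
    rintro a (ha | ha) b (hb | hb)
    · exact hdist a ha b hb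
    · rw [dist_comm]; exact hεC b (closedBall_subset_closedBall hη1 hb) a ha
    · exact hεC a (closedBall_subset_closedBall hη1 ha) b hb
    · have := dist_triangle_right a b x
      rw [mem_closedBall] at ha hb
      linarith) z
  rw [measure_union hdisj measurableSet_closedBall, ← hV] at hle
  exact (ENNReal.lt_add_right hC.measure_lt_top.ne
    (measure_closedBall_pos volume x hη).ne').not_ge hle

namespace IsDiametricallyComplete

variable {D : ℝ} {C : Set (HyperbolicSpace n)}

theorem mem_interior (hC : IsDiametricallyComplete D C) {x : HyperbolicSpace n}
    (h : ∀ c ∈ C, dist x c < D) : x ∈ interior C := by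
  obtain ⟨ε, hε, hx⟩ := exists_closedBall_dist_le hC.isCompact h
  rw [mem_interior_iff_mem_nhds]
  exact mem_of_superset (closedBall_mem_nhds x hε) fun y hy => hC.mem_of_dist_le y (hx y hy)

theorem exists_dist_eq (hC : IsDiametricallyComplete D C) {x : HyperbolicSpace n} (hx : x ∈ C)
    (hx' : x ∉ interior C) : ∃ w ∈ C, dist x w = D := by
  by_contra! h
  exact hx' (hC.mem_interior fun c hc => lt_of_le_of_ne (hC.dist_le x hx c hc) (h c hc))

theorem mem_interior_of_between (hC : IsDiametricallyComplete D C) {a x b : HyperbolicSpace n}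
    (ha : a ∈ C) (hb : b ∈ C) (hax : a ≠ x) (hxb : x ≠ b)
    (h : dist a x + dist x b = dist a b) : x ∈ interior C :=
  hC.mem_interior fun c hc =>
    dist_lt_of_between hax hxb h (hC.dist_le a ha c hc) (hC.dist_le b hb c hc)

theorem nonempty_interior (hC : IsDiametricallyComplete D C) (hD : 0 < D) :
    (interior C).Nonempty := by
  obtain ⟨c, hc⟩ := hC.nonempty
  by_cases hcC : c ∈ interior C
  · exact ⟨c, hcC⟩
  obtain ⟨w, hw, hcw⟩ := hC.exists_dist_eq hc hcC
  have hne : c ≠ w := by rw [← dist_pos, hcw]; exact hD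
  obtain ⟨x, h1, h2⟩ := exists_dist_eq_sub hne (half_pos hD).le (by linarith)
  refine ⟨x, hC.mem_interior_of_between hc hw ?_ ?_ (by linarith)⟩
  · rw [← dist_pos, h1]; linarith
  · rw [← dist_pos, h2]; linarith

theorem notMem_interior (hC : IsDiametricallyComplete D C) (hD : 0 < D) {x w : HyperbolicSpace n}
    (hx : x ∈ C) (hxw : dist x w = D) : w ∉ interior C := by
  intro hw
  obtain ⟨ε, hε, hball⟩ := Metric.isOpen_iff.1 isOpen_interior w hw
  have hne : x ≠ w := by rw [← dist_pos, hxw]; exact hD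
  obtain ⟨y, h1, h2⟩ := exists_dist_eq_add hne (half_pos hε).le
  have hy : y ∈ C := interior_subset (hball (by rw [mem_ball, dist_comm]; linarith))
  have := hC.dist_le x hx y hy
  linarith

/-- If the two-point symmetrization of `C` is complete, then any two boundary points have
antipodes that correspond to each other under the reflection. -/
theorem exists_refl_mem (hC : IsDiametricallyComplete D C) {p q : HyperbolicSpace n}
    (h : p ≠ q) (hT : IsDiametricallyComplete D (twoPoint p q C)) (hp : p ∈ C)
    (hp' : p ∉ interior C) (hq : q ∈ C) (hq' : q ∉ interior C) :
    ∃ w ∈ C, refl p q w ∈ C ∧ dist p w = D := by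
  have hpT : p ∈ twoPoint p q C := Or.inr ⟨Or.inl hp, by simp⟩
  -- Otherwise the symmetrization contains a point `x` just beyond `p` on the geodesic from `q`. If
  -- `x ∈ C`, then `p` is interior to `C`; if its mirror image is in `C`, then `q` is.
  have hpT' : p ∉ interior (twoPoint p q C) := by
    intro hpi
    obtain ⟨ε, hε, hball⟩ := Metric.isOpen_iff.1 isOpen_interior p hpi
    obtain ⟨x, h1, h2⟩ := exists_dist_eq_add h.symm (half_pos hε).le
    have hpx : p ≠ x := by rw [← dist_pos, h1]; exact half_pos hε
    have hx : x ∈ twoPoint p q C :=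
      interior_subset (hball (by rw [mem_ball, dist_comm]; linarith))
    have hx' : x ∈ C ∨ refl p q x ∈ C := by
      rcases hx with hx | hx
      · exact Or.inl hx.1
      · exact hx.1
    rcases hx' with hx' | hx'
    · exact hp' (hC.mem_interior_of_between hq hx' h.symm hpx (by linarith))
    · have e1 : dist q (refl p q x) = dist p x := by
        rw [← dist_refl_left h, refl_right h]
      have e2 : dist p (refl p q x) = dist q x := by
        rw [← dist_refl_left h, refl_left h]
      have hqx : q ≠ refl p q x := by rw [← dist_pos, e1]; exact dist_pos.2 hpx
      refine hq' (hC.mem_interior_of_between hp hx' h hqx ?_)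
      rw [e1, e2, dist_comm p q]; linarith
  obtain ⟨w, hw, hpw⟩ := hT.exists_dist_eq hpT hpT'
  rcases hw with hw | ⟨hw, hwP⟩
  · exact ⟨w, hw.1, hw.2, hpw⟩
  -- Since `w` is on the side of `p` and already at distance `D` from it, this bound forces `w` onto
  -- the bisector, where it is fixed.
  have hwq : dist w q ≤ D := by
    rcases hw with hw | hw
    · exact hC.dist_le w hw q hq
    · rw [← refl_left h, ← dist_refl_left h]
      exact hC.dist_le _ hw p hp
  have heq : dist w p = dist w q := by
    refine le_antisymm hwP ?_
    rw [dist_comm w p, hpw]; exact hwq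
  have hfix := refl_eq_self h heq
  rw [mem_union, mem_preimage, hfix, or_self] at hw
  exact ⟨w, hw, by rwa [hfix], hpw⟩

end IsDiametricallyComplete

/-- `w` is the only point of `C` at distance `D` from the boundary point `p` of `C`. -/
structure IsUniqueAntipode (D : ℝ) (C : Set (HyperbolicSpace n)) (p w : HyperbolicSpace n) :
    Prop where
  left_mem : p ∈ C
  left_notMem : p ∉ interior C
  right_mem : w ∈ C
  dist_eq : dist p w = D
  eq_of_dist_eq : ∀ v ∈ C, dist p v = D → v = w

/-! ### Boundary points with a unique antipode -/

namespace IsDiametricallyComplete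

variable {D : ℝ} {C : Set (HyperbolicSpace n)}

/-- The boundary point nearest to an interior point `o` has a unique antipode, and `o` lies
between the two. -/
theorem exists_isUniqueAntipode [Nontrivial (HyperbolicSpace n)]
    (hC : IsDiametricallyComplete D C) (hD : 0 < D) {o : HyperbolicSpace n}
    (ho : o ∈ interior C) :
    ∃ p w, IsUniqueAntipode D C p w ∧ (∀ z ∉ interior C, dist o p ≤ dist o z) ∧
      p ≠ o ∧ o ≠ w ∧ dist p o + dist o w = dist p w := by
  have hne : ((interior C)ᶜ).Nonempty := by
    obtain ⟨y, hy⟩ := exists_ne o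
    obtain ⟨x, h1, h2⟩ := exists_dist_eq_add hy.symm hD.le
    refine ⟨x, fun hx => ?_⟩
    have := hC.dist_le o (interior_subset ho) x (interior_subset hx)
    have := dist_pos.2 hy.symm
    linarith
  obtain ⟨p, hp, hop⟩ := (isOpen_interior (s := C)).isClosed_compl.exists_infDist_eq_dist hne o
  have hnear : ∀ z ∉ interior C, dist o p ≤ dist o z := fun z hz => by
    rw [← hop]; exact infDist_le_dist_of_mem hz
  have hpo : p ≠ o := fun h => hp (h ▸ ho)
  have hr : 0 < dist o p := dist_pos.2 hpo.symm
  have hball : ball o (dist o p) ⊆ C := by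
    intro x hx
    by_contra hxC
    have := hnear x fun h => hxC (interior_subset h)
    rw [mem_ball, dist_comm] at hx
    linarith
  have hpC : p ∈ C := by
    refine hC.isCompact.isClosed.closure_subset_iff.2 hball
      (closedBall_subset_closure_ball o hr ?_)
    rw [mem_closedBall, dist_comm]
  -- If `o` were off the segment `pv`, prolonging the geodesic from `v` through `o` inside the
  -- inscribed ball would reach a point of `C` farther than `D` from `v`.
  have hbetween : ∀ v ∈ C, dist p v = D → dist p o + dist o v = D := by
    intro v hv hpv
    refine le_antisymm ?_ (hpv ▸ dist_triangle p o v)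
    by_cases hov : v = o
    · rw [hov, dist_self, add_zero, ← hpv, hov]
    by_contra! hlt
    have h0 : 0 ≤ max 0 (D - dist o v) := le_max_left _ _
    have h1 : max 0 (D - dist o v) < dist o p := by
      rw [max_lt_iff]
      rw [dist_comm p o] at hlt
      exact ⟨hr, by linarith⟩
    obtain ⟨t, ht1, ht2⟩ := exists_between h1
    obtain ⟨x, hx1, hx2⟩ := exists_dist_eq_add hov (h0.trans ht1.le)
    have hxC : x ∈ C := hball (by rw [mem_ball, dist_comm]; linarith)
    have h2 := hC.dist_le v hv x hxC
    have h3 := le_max_right 0 (D - dist o v)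
    rw [dist_comm v o] at hx2
    linarith
  obtain ⟨w, hw, hpw⟩ := hC.exists_dist_eq hpC hp
  have how : o ≠ w := fun h => hC.notMem_interior hD hpC hpw (h ▸ ho)
  refine ⟨p, w, ⟨hpC, hp, hw, hpw, fun v hv hpv => ?_⟩, hnear, hpo, how,
    (hbetween w hw hpw).trans hpw.symm⟩
  have hv1 := hbetween v hv hpv
  have hw1 := hbetween w hw hpw
  have hpv' : p ≠ v := by rw [← dist_pos, hpv]; exact hD
  have hpw' : p ≠ w := by rw [← dist_pos, hpw]; exact hD
  have e1 := eq_of_dist_add_dist hpv' (hv1.trans hpv.symm)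
  have e2 := eq_of_dist_add_dist hpw' (hw1.trans hpw.symm)
  have e3 : dist o v = dist o w := by linarith
  rw [e1, e3, hpv, hpw] at e2
  have hs : Real.sinh (dist p o) / Real.sinh D ≠ 0 :=
    (div_pos (Real.sinh_pos_iff.2 (dist_pos.2 hpo)) (Real.sinh_pos_iff.2 hD)).ne'
  exact Subtype.ext (smul_right_injective _ hs (add_left_cancel e2))

theorem mem_closure_interior (hC : IsDiametricallyComplete D C) (hD : 0 < D)
    {w : HyperbolicSpace n} (hw : w ∈ C) : w ∈ closure (interior C) := by
  obtain ⟨o, ho⟩ := hC.nonempty_interior hD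
  by_cases how : w = o
  · rw [how]; exact subset_closure ho
  have hpos := dist_pos.2 how
  rw [Metric.mem_closure_iff]
  intro ε hε
  have htpos : 0 < min (ε / 2) (dist w o / 2) := by positivity
  have ht1 := min_le_left (ε / 2) (dist w o / 2)
  have ht2 := min_le_right (ε / 2) (dist w o / 2)
  obtain ⟨x, h1, h2⟩ := exists_dist_eq_sub how htpos.le (by linarith)
  refine ⟨x, hC.mem_interior_of_between hw (interior_subset ho) ?_ ?_ (by linarith), ?_⟩
  · rw [← dist_pos, h1]; exact htpos
  · rw [← dist_pos, h2]; linarith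
  · linarith

/-- For an interior point `o` near `z`, the boundary point nearest to `o` is no farther from `o`
than `z` is. -/
theorem exists_isUniqueAntipode_near [Nontrivial (HyperbolicSpace n)]
    (hC : IsDiametricallyComplete D C) (hD : 0 < D) {z : HyperbolicSpace n}
    (hz : z ∈ closure (interior C)) (hz' : z ∉ interior C) {ε : ℝ} (hε : 0 < ε) :
    ∃ p w, IsUniqueAntipode D C p w ∧ dist p z < ε := by
  obtain ⟨o, ho, hzo⟩ := Metric.mem_closure_iff.1 hz (ε / 2) (half_pos hε)
  obtain ⟨p, w, hpw, hnear, -⟩ := hC.exists_isUniqueAntipode hD ho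
  refine ⟨p, w, hpw, ?_⟩
  have h1 := hnear z hz'
  have h2 := dist_triangle_left p z o
  rw [dist_comm z o] at hzo
  linarith

/-- `exists_refl_mem` yields an antipode of `p` whose image is an antipode of `p'`; uniqueness
identifies both. -/
theorem eq_refl_of_isUniqueAntipode (hC : IsDiametricallyComplete D C)
    (hT : ∀ p q, p ≠ q → IsDiametricallyComplete D (twoPoint p q C))
    {p w p' w' : HyperbolicSpace n} (h : IsUniqueAntipode D C p w)
    (h' : IsUniqueAntipode D C p' w') (hne : p ≠ p') : refl p p' w = w' := by
  obtain ⟨v, hv, hv', hpv⟩ := hC.exists_refl_mem hne (hT p p' hne) h.left_mem h.left_notMem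
    h'.left_mem h'.left_notMem
  rw [h.eq_of_dist_eq v hv hpv] at hv' hpv
  refine h'.eq_of_dist_eq _ hv' ?_
  rw [← dist_refl_left hne, refl_right hne, hpv]

/-- Three distinct boundary points of a complete set do not lie on a line. -/
theorem ne_smul_add_smul (hC : IsDiametricallyComplete D C) {x p w : HyperbolicSpace n}
    (hx : x ∈ C) (hx' : x ∉ interior C) (hp : p ∈ C) (hp' : p ∉ interior C) (hw : w ∈ C)
    (hw' : w ∉ interior C) (hpw : p ≠ w) (hxp : x ≠ p) (hxw : x ≠ w) (a b : ℝ) :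
    x.1 ≠ a • p.1 + b • w.1 := by
  have key : ∀ {x p w : HyperbolicSpace n} {a b : ℝ}, x ∉ interior C → p ∈ C → w ∈ C →
      p ≠ w → 0 < a → 0 < b → x.1 ≠ a • p.1 + b • w.1 := by
    intro x p w a b hx' hp hw hpw ha hb h
    exact hx' (hC.mem_interior fun c hc =>
      dist_lt_of_eq_add ha hb h hpw (hC.dist_le p hp c hc) (hC.dist_le w hw c hc))
  have key0 : ∀ {x p : HyperbolicSpace n} {a : ℝ}, x ≠ p → x.1 ≠ a • p.1 := by
    intro x p a hxp h
    have h1 : lorentz x.1 p.1 = a := by rw [h, lorentz_smul_left, lorentz_self, mul_one]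
    have h2 : a * lorentz x.1 p.1 = 1 := by
      rw [lorentz_comm, ← lorentz_smul_left, ← h, lorentz_self]
    have := one_lt_lorentz hxp
    rw [← h1] at h2
    nlinarith
  intro h
  have h1 : a * lorentz p.1 x.1 + b * lorentz w.1 x.1 = 1 := by
    rw [← lorentz_smul_left, ← lorentz_smul_left, ← lorentz_add_left, ← h, lorentz_self]
  have hpx := lorentz_pos p x
  have hwx := lorentz_pos w x
  -- The signs decide which of the three points is the middle one; solving for it exhibits a
  -- boundary point as a positive combination of two points of `C`.
  rcases lt_trichotomy a 0 with ha | ha | ha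
  · have hb : 0 < b := by
      by_contra! hb
      nlinarith
    refine key (x := w) (p := x) (w := p) (a := b⁻¹) (b := -a / b) hw' hx hp hxp
      (by positivity) (div_pos (neg_pos.2 ha) hb) ?_
    rw [h]
    match_scalars <;> field_simp
    ring
  · rw [ha, zero_smul, zero_add] at h
    exact key0 hxw h
  rcases lt_trichotomy b 0 with hb | hb | hb
  · refine key (x := p) (p := x) (w := w) (a := a⁻¹) (b := -b / a) hp' hx hw hxw
      (by positivity) (div_pos (neg_pos.2 hb) ha) ?_
    rw [h]
    match_scalars <;> field_simp
    ring
  · rw [hb, zero_smul, add_zero] at h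
    exact key0 hxp h
  · exact key hx' hp hw hpw ha hb h

/-- The point `w` need not have a unique antipode, so it is approximated by boundary points `q k`
that do. The antipode of `q k` is the image of `w` under one reflection and of `w'` under another;
equating the two and letting `q k` tend to `w` gives the claim. -/
theorem refl_eq_of_isUniqueAntipode [Nontrivial (HyperbolicSpace n)]
    (hC : IsDiametricallyComplete D C) (hD : 0 < D)
    (hT : ∀ p q, p ≠ q → IsDiametricallyComplete D (twoPoint p q C))
    {p w p' w' : HyperbolicSpace n} (h : IsUniqueAntipode D C p w)
    (h' : IsUniqueAntipode D C p' w') (hne : p' ≠ w) : refl p' w w' = p := by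
  have hpw : p ≠ w := by rw [← dist_pos, h.dist_eq]; exact hD
  have hex : ∀ k : ℕ, ∃ q, refl p q w = refl p' q w' ∧ p ≠ q ∧ p' ≠ q ∧
      dist q w < 1 / ((k : ℝ) + 1) := by
    intro k
    have hk : (0 : ℝ) < 1 / ((k : ℝ) + 1) := by positivity
    have h1 := dist_pos.2 hpw
    have h2 := dist_pos.2 hne
    obtain ⟨q, v, hqv, hq⟩ := hC.exists_isUniqueAntipode_near hD
      (hC.mem_closure_interior hD h.right_mem) (hC.notMem_interior hD h.left_mem h.dist_eq)
      (ε := min (1 / ((k : ℝ) + 1)) (min (dist p w) (dist p' w))) (by positivity)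
    rw [lt_min_iff, lt_min_iff] at hq
    have hpq : p ≠ q := by
      rintro rfl; exact hq.2.1.false
    have hpq' : p' ≠ q := by
      rintro rfl; exact hq.2.2.false
    exact ⟨q, (hC.eq_refl_of_isUniqueAntipode hT h hqv hpq).trans
      (hC.eq_refl_of_isUniqueAntipode hT h' hqv hpq').symm, hpq, hpq', hq.1⟩
  choose q hq hpq hpq' hqw using hex
  have hlim : Tendsto q atTop (𝓝 w) := tendsto_iff_dist_tendsto_zero.2
    (squeeze_zero (fun _ => dist_nonneg) (fun k => (hqw k).le)
      tendsto_one_div_add_atTop_nhds_zero_nat)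
  have hL : ∀ x : HyperbolicSpace n,
      Tendsto (fun k => lorentz x.1 (q k).1) atTop (𝓝 (lorentz x.1 w.1)) := fun x =>
    ((continuous_lorentz.comp (Continuous.prodMk continuous_const continuous_id)).tendsto w).comp
      hlim
  have lim1 : Tendsto (fun k => lorentz (refl p' (q k) w').1 p.1) atTop
      (𝓝 (lorentz (refl p' w w').1 p.1)) := by
    simp only [lorentz_refl hne, fun k => lorentz_refl (hpq' k)]
    have hden : lorentz p'.1 w.1 - 1 ≠ 0 := by have := one_lt_lorentz hne; linarith
    exact tendsto_const_nhds.add (((tendsto_const_nhds.sub (hL w')).div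
      ((hL p').sub_const 1) hden).mul (tendsto_const_nhds.sub (hL p)))
  have lim2 : Tendsto (fun k => lorentz (refl p' (q k) w').1 p.1) atTop (𝓝 1) := by
    have : ∀ k, lorentz (refl p' (q k) w').1 p.1 = lorentz w.1 (q k).1 := fun k => by
      rw [← dist_eq_dist_iff, ← hq, dist_refl_left (hpq k), refl_left (hpq k)]
    simp only [this]
    simpa only [lorentz_self] using hL w
  exact eq_of_lorentz_eq_one (tendsto_nhds_unique lim1 lim2)

/-- The two reflection identities read `w' = w + c(p - p')` and `p = w' + d(p' - w)`. Eliminating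
`w'` puts `p'` on the line through `p` and `w`, which is impossible, unless `d = c`; then `c = 1`,
which is the claim. -/
theorem lorentz_add_lorentz_eq [Nontrivial (HyperbolicSpace n)]
    (hC : IsDiametricallyComplete D C) (hD : 0 < D)
    (hT : ∀ p q, p ≠ q → IsDiametricallyComplete D (twoPoint p q C))
    {p w p' w' : HyperbolicSpace n} (h : IsUniqueAntipode D C p w)
    (h' : IsUniqueAntipode D C p' w') :
    lorentz p'.1 p.1 + lorentz p'.1 w.1 = 1 + Real.cosh D := by
  have hpw : p ≠ w := by rw [← dist_pos, h.dist_eq]; exact hD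
  have hcosh : lorentz p.1 w.1 = Real.cosh D := by rw [← cosh_dist, h.dist_eq]
  by_cases h1 : p = p'
  · rw [← h1, lorentz_self, hcosh]
  by_cases h2 : p' = w
  · rw [h2, lorentz_self, lorentz_comm, hcosh, add_comm]
  have e1 := congrArg Subtype.val (hC.eq_refl_of_isUniqueAntipode hT h h' h1)
  have e2 := congrArg Subtype.val (hC.refl_eq_of_isUniqueAntipode hD hT h h' h2)
  rw [refl_val h1, reflVec] at e1
  rw [refl_val h2, reflVec] at e2
  have hden : lorentz p.1 p'.1 - 1 ≠ 0 := by have := one_lt_lorentz h1; linarith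
  set c := (lorentz w.1 p.1 - lorentz w.1 p'.1) / (lorentz p.1 p'.1 - 1) with hc
  set d := (lorentz w'.1 p'.1 - lorentz w'.1 w.1) / (lorentz p'.1 w.1 - 1)
  rw [← e1] at e2
  have e3 : (d - c) • p'.1 = (1 - c) • p.1 + (-(1 - d)) • w.1 := by
    rw [← sub_eq_zero] at e2 ⊢
    rw [← e2]
    module
  by_cases hcd : d = c
  · rw [hcd, sub_self, zero_smul, neg_smul, ← sub_eq_add_neg, ← smul_sub] at e3
    have hc1 : c = 1 := by
      rcases smul_eq_zero.1 e3.symm with h0 | h0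
      · linarith
      · exact absurd (Subtype.ext (sub_eq_zero.1 h0)) hpw
    rw [hc, div_eq_one_iff_eq hden, lorentz_comm w.1 p.1, hcosh] at hc1
    rw [lorentz_comm p'.1 p.1, lorentz_comm p'.1 w.1]
    linarith
  · have hdc : d - c ≠ 0 := sub_ne_zero.2 hcd
    refine absurd ?_ (hC.ne_smul_add_smul h'.left_mem h'.left_notMem h.left_mem h.left_notMem
      h.right_mem (hC.notMem_interior hD h.left_mem h.dist_eq) hpw (Ne.symm h1) h2
      ((d - c)⁻¹ * (1 - c)) ((d - c)⁻¹ * (-(1 - d))))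
    rw [mul_smul, mul_smul, ← smul_add, ← e3, smul_smul, inv_mul_cancel₀ hdc, one_smul]

theorem exists_eq_closedBall [Nontrivial (HyperbolicSpace n)]
    (hC : IsDiametricallyComplete D C) (hD : 0 < D)
    (hT : ∀ p q, p ≠ q → IsDiametricallyComplete D (twoPoint p q C)) :
    ∃ m, C = closedBall m (D / 2) := by
  obtain ⟨o, ho⟩ := hC.nonempty_interior hD
  obtain ⟨p, w, hpw, -, hpo, how, hbet⟩ := hC.exists_isUniqueAntipode hD ho
  have hne : p ≠ w := by rw [← dist_pos, hpw.dist_eq]; exact hD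
  obtain ⟨m, hpm, hmw⟩ := exists_dist_eq_sub hne (half_pos hD).le
    (by rw [hpw.dist_eq]; linarith)
  rw [hpw.dist_eq, sub_half] at hmw
  -- The midpoint `m` is a multiple of `p + w`, so a constant value of `𝓑(p', p) + 𝓑(p', w)` means a
  -- constant distance to `m`.
  have hsphere : ∀ {p' w'}, IsUniqueAntipode D C p' w' → dist p' m = D / 2 := by
    intro p' w' h'
    have e := eq_of_dist_add_dist hne (x := m) (by rw [hpm, hmw, hpw.dist_eq]; ring)
    rw [hpm, hmw, ← smul_add] at e
    rw [← hpm, dist_eq_dist_iff, e, lorentz_smul_right, lorentz_smul_right, lorentz_add_right,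
      lorentz_add_right, hC.lorentz_add_lorentz_eq hD hT hpw h', lorentz_self, ← cosh_dist,
      hpw.dist_eq]
  have hoB : o ∈ ball m (D / 2) :=
    dist_lt_of_between hpo how hbet hpm.le (by rw [dist_comm]; exact hmw.le)
  -- By connectedness, failure would produce a boundary point inside the ball, and near it boundary
  -- points with a unique antipode, which must lie on the sphere.
  have hball : ball m (D / 2) ⊆ interior C := by
    refine (isPreconnected_ball m (D / 2)).subset_of_closure_inter_subset isOpen_interior
      ⟨o, hoB, ho⟩ ?_
    rintro z ⟨hz, hzB⟩
    by_contra hz'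
    rw [mem_ball] at hzB
    obtain ⟨p', w', h', hz''⟩ := hC.exists_isUniqueAntipode_near hD hz hz' (sub_pos.2 hzB)
    have h1 := hsphere h'
    have h2 := dist_triangle p' z m
    linarith
  have hclosed : closedBall m (D / 2) ⊆ C :=
    (closedBall_subset_closure_ball m (half_pos hD)).trans
      (hC.isCompact.isClosed.closure_subset_iff.2 (hball.trans interior_subset))
  refine ⟨m, subset_antisymm (fun c hc => ?_) hclosed⟩
  by_contra hcm
  rw [mem_closedBall, not_le] at hcm
  have hcne : c ≠ m := by rw [← dist_pos]; linarith
  obtain ⟨x, h1, h2⟩ := exists_dist_eq_add hcne (half_pos hD).le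
  have := hC.dist_le c hc x (hclosed (by rw [mem_closedBall, dist_comm, h1]))
  linarith

end IsDiametricallyComplete

/-- Symmetrization keeps the volume and the diameter bound, so every symmetrization of `C` is
extremal too, hence complete. -/
theorem exists_eq_closedBall_of_volume_eq [Nontrivial (HyperbolicSpace n)]
    {C : Set (HyperbolicSpace n)} (hC : IsCompact C) {D : ℝ} (hD : 0 < D)
    (hdist : ∀ x ∈ C, ∀ y ∈ C, dist x y ≤ D) {z : HyperbolicSpace n}
    (hV : volume C = volume (closedBall z (D / 2))) : ∃ m, C = closedBall m (D / 2) :=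
  (isDiametricallyComplete_of_volume_eq hC hD hdist hV).exists_eq_closedBall hD fun _ _ h =>
    isDiametricallyComplete_of_volume_eq (isCompact_twoPoint h hC) hD
      (dist_le_of_mem_twoPoint h hdist) ((volume_twoPoint h hC.measurableSet).trans hV)

end HyperbolicSpace

/-! ### Passage from compact sets to measurable sets through the closure -/

open HyperbolicSpace in
theorem theorem1p1 (n : ℕ) (hn : 2 ≤ n) (D : ℝ) (hD : 0 < D) (z₀ : HyperbolicSpace n)
    (X : Set (HyperbolicSpace n)) (hX : NullMeasurableSet X volume)
    (hbdd : Bornology.IsBounded X) (hdiam : Metric.diam X ≤ D) :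
    volume X ≤ volume (Metric.closedBall z₀ (D / 2)) ∧
    (volume X = volume (Metric.closedBall z₀ (D / 2)) ↔
      (∃ z : HyperbolicSpace n, closure X = Metric.closedBall z (D / 2)) ∧
        volume (closure X \ X) = 0) := by
  have : Nonempty (Fin n) := ⟨⟨0, by omega⟩⟩
  have : Nontrivial (HyperbolicSpace n) := param_bijective.1.nontrivial
  have hcompact : IsCompact (closure X) := hbdd.isCompact_closure
  have hdist : ∀ x ∈ closure X, ∀ y ∈ closure X, dist x y ≤ D := fun x hx y hy =>
    (Metric.dist_le_diam_of_mem hbdd.closure hx hy).trans (by rwa [Metric.diam_closure])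
  have hsub : volume X ≤ volume (closure X) := measure_mono subset_closure
  have hle := volume_le_of_isCompact hcompact hD hdist z₀
  have hfin : volume X ≠ ⊤ := (hsub.trans_lt hcompact.measure_lt_top).ne
  have hadd : volume (closure X \ X) + volume X = volume (closure X) := by
    rw [measure_sdiff subset_closure hX hfin, tsub_add_cancel_of_le hsub]
  refine ⟨hsub.trans hle, fun h => ?_, ?_⟩
  · have heq : volume (closure X) = volume X := le_antisymm (hle.trans h.ge) hsub
    refine ⟨exists_eq_closedBall_of_volume_eq hcompact hD hdist (heq.trans h), ?_⟩
    rw [measure_sdiff subset_closure hX hfin, heq, tsub_self]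
  · rintro ⟨⟨z, hz⟩, h0⟩
    rw [h0, zero_add] at hadd
    rw [hadd, hz, volume_closedBall_eq z z₀]
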